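/- Let $K$ be a field. A *finite $O$-sequence* is a sequence $(a_0,a_1,\dots,a_s)$, $a_s\neq 0$ (extended by $a_i=0$ for $i>s$), that is the Hilbert function $t\mapsto \dim_K R_t-\dim_K I_t$ of a nonzero Artinian quotient $R/I$ of a standard graded polynomial ring $R=K[x_1,\dots,x_q]$ (for some $q$) by a homogeneous ideal $I$; its *socle degree* is $s$ and its *multiplicity* is $\sum_i a_i$. For $d\ge 1$ let $O_d$ be the number of finite $O$-sequences of multiplicity $d$. Order the variables by $x_1<\dots<x_p$. A monomial ideal $J\subseteq K[x_1,\dots,x_p]$ is a *lex-segment ideal* if its *sous-escalier* $\mathcal N(J)$ (the set of terms not in $J$) contains, with each term $\tau$, every term of the same degree that is lower than $\tau$ in the lexicographic order. For integers $p,d\ge 1$ and $n,k\ge 0$, let $M(p,n,k,d)$ be the set of sous-escaliers of those Artinian lex-segment ideals $J\subseteq K[x_1,\dots,x_p]$ for which the Hilbert function $(a_i)_{i\ge0}$ of $K[x_1,\dots,x_p]/J$ has multiplicity $d$ and socle degree at most $n$, and satisfies $a_i=\binom{p-1+i}{i}$ for $0\le i\le k$ and $a_i<\binom{p-1+i}{i}$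 for all $i>k$. Let $O(p,n,k,d)=|M(p,n,k,d)|$. **Corollary.** All the sets counted above are finite, and the following hold. 1. $O_d=O(d,d-1,0,d)$ for every $d\ge1$. 2. $O(1,n,k,d)=1$ if $k=d-1$ and $n\ge d-1$, and $O(1,n,k,d)=0$ otherwise, for all $n,k\ge0$, $d\ge1$. 3. $O(p,n,0,d)=\sum_{k=0}^{d-1}O(p-1,n,k,d)$ for all $p\ge2$, $n\ge0$, $d\ge1$. 4. For all $p\ge2$, $n\ge0$, $k\ge1$, $d\ge1$, $$O(p,n,k,d)=\sum_{j=1}^{d-1}\sum_{i=k}^{n}O(p-1,n,i,d-j)\cdot O(p,i-1,k-1,j).$$ Moreover these relations form an iterative formula: let $F(p,n,k,d)$ ($p,d\ge1$, $n,k\ge0$) be the function defined by recursion on $(p,k)$, ordered lexicographically, by the right-hand side of 2 for $p=1$, and, for $p\ge2$, by the right-hand sides of 3 (for $k=0$) and 4 (for $k\ge1$) with $O(\cdot,\cdot,\cdot,\cdot)$ replaced by $F$. Then $O(p,n,k,d)=F(p,n,k,d)$ for all $p,d\ge1$, $n,k\ge0$, and in particular $O_d=F(d,d-1,0,d)$ for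 every $d\ge2$. -/

import Mathlib

open scoped BigOperators

noncomputable section

namespace OSeq

open MvPolynomial

attribute [local instance] MvPolynomial.gradedAlgebra

/-- The Hilbert function `t ↦ dim R_t - dim I_t` of the graded quotient `R / I`, for an ideal `I`
of `R = K[x_1, …, x_p]`. Here `R_t` is the space of homogeneous polynomials of degree `t`
and `I_t = R_t ∩ I`. -/
def hilbertFn {K : Type*} [Field K] {p : ℕ} (I : Ideal (MvPolynomial (Fin p) K)) (t : ℕ) : ℕ :=
  Module.finrank K (homogeneousSubmodule (Fin p) K t) -
    Module.finrank K
      (homogeneousSubmodule (Fin p) K t ⊓ I.restrictScalars K :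
        Submodule K (MvPolynomial (Fin p) K))

/-- `a` is a finite `O`-sequence (extended by zeros): the Hilbert function of a nonzero Artinian
quotient of a polynomial ring in finitely many variables over `K` by a homogeneous ideal. -/
def IsFiniteOSequence (K : Type*) [Field K] (a : ℕ → ℕ) : Prop :=
  ∃ (p : ℕ) (I : Ideal (MvPolynomial (Fin p) K)),
    I.IsHomogeneous (homogeneousSubmodule (Fin p) K) ∧ I ≠ ⊤ ∧
    IsArtinianRing (MvPolynomial (Fin p) K ⧸ I) ∧ a = hilbertFn I

/-- The multiplicity (length) `∑ a_i` of a finitely supported numerical function. -/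
def multiplicity (a : ℕ → ℕ) : ℕ := ∑ᶠ i, a i

/-- `s` is the socle degree of `a`: the last index at which `a` is nonzero. -/
def IsSocleDegree (a : ℕ → ℕ) (s : ℕ) : Prop := a s ≠ 0 ∧ ∀ i, s < i → a i = 0

/-- The set of all finite `O`-sequences of multiplicity `d`. -/
def finiteOSequences (K : Type*) [Field K] (d : ℕ) : Set (ℕ → ℕ) :=
  {a | IsFiniteOSequence K a ∧ multiplicity a = d}

/-- The number `O_d` of finite `O`-sequences of multiplicity `d`. -/
def numO (K : Type*) [Field K] (d : ℕ) : ℕ := (finiteOSequences K d).ncard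

/-- A monomial ideal: an ideal generated by a set of terms. -/
def IsMonomialIdeal {K : Type*} [Field K] {p : ℕ} (J : Ideal (MvPolynomial (Fin p) K)) : Prop :=
  ∃ S : Set (Fin p →₀ ℕ), J = Ideal.span ((fun α => monomial α (1 : K)) '' S)

/-- The sous-escalier of `J`: the terms outside `J`, each term `x^α` given by its exponent `α`. -/
def sousEscalier {K : Type*} [Field K] {p : ℕ} (J : Ideal (MvPolynomial (Fin p) K)) :
    Set (Fin p →₀ ℕ) :=
  {α | monomial α (1 : K) ∉ J}

/-- Strict lexicographic term order with `x_1 < ⋯ < x_p`: `σ < τ` if at the largest index at which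
the exponents differ the exponent of `σ` is the smaller one. -/
def LexLT {p : ℕ} (σ τ : Fin p →₀ ℕ) : Prop := Finsupp.Lex (· > ·) (· < ·) σ τ

/-- Lex-segment ideals: monomial ideals whose sous-escalier contains, with each term `τ`, all terms
of the same degree that are lexicographically lower than `τ`. -/
def IsLexSegmentIdeal {K : Type*} [Field K] {p : ℕ} (J : Ideal (MvPolynomial (Fin p) K)) : Prop :=
  IsMonomialIdeal J ∧
    ∀ τ ∈ sousEscalier J, ∀ σ : Fin p →₀ ℕ, σ.degree = τ.degree → LexLT σ τ → σ ∈ sousEscalier J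

/-- `M(p, n, k, d)`: the sous-escaliers of the Artinian lex-segment ideals `J` of
`K[x_1, …, x_p]` whose quotient has multiplicity `d` and socle degree at most `n`, and whose
Hilbert function attains the maximal value `binom (p - 1 + i) i` exactly in the degrees `i ≤ k`. -/
def lexSousEscaliers (K : Type*) [Field K] (p n k d : ℕ) : Set (Set (Fin p →₀ ℕ)) :=
  {M | ∃ J : Ideal (MvPolynomial (Fin p) K),
    IsLexSegmentIdeal J ∧ IsArtinianRing (MvPolynomial (Fin p) K ⧸ J) ∧ M = sousEscalier J ∧
    multiplicity (hilbertFn J) = d ∧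
    (∃ s ≤ n, IsSocleDegree (hilbertFn J) s) ∧
    (∀ i ≤ k, hilbertFn J i = (p - 1 + i).choose i) ∧
    (∀ i, k < i → hilbertFn J i < (p - 1 + i).choose i)}

/-- `O(p, n, k, d)`, the cardinality of `M(p, n, k, d)`. -/
def numLex (K : Type*) [Field K] (p n k d : ℕ) : ℕ := (lexSousEscaliers K p n k d).ncard

end OSeq

end

/-- The function of `(p, n, k, d)` computed by the iteration (only `p, d ≥ 1` matter): the value
for `p = 1` is explicit; a value with `p ≥ 2`, `k = 0` is a sum of values for `p - 1`; a value with
`p ≥ 2`, `k ≥ 1` is a sum of products of a value for `p - 1` and a value for `p` and `k - 1`. -/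
def OSeq.iter : ℕ → ℕ → ℕ → ℕ → ℕ
  | 0, _, _, _ => 0
  | 1, n, k, d => if k + 1 = d ∧ d ≤ n + 1 then 1 else 0
  | p + 2, n, 0, d => ∑ k ∈ Finset.range d, OSeq.iter (p + 1) n k d
  | p + 2, n, k + 1, d =>
      ∑ j ∈ Finset.Icc 1 (d - 1), ∑ i ∈ Finset.Icc (k + 1) n,
        OSeq.iter (p + 1) n i (d - j) * OSeq.iter (p + 2) (i - 1) k j
  termination_by p _ k _ => (p, k)

/-!
Lex-segment ideals are studied through their sous-escaliers: finite sets of terms closed under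
divisors and, in each degree, under passing to lexicographically lower terms. All terms are taken
in one sequence of variables `x_0 < x_1 < ⋯`, so that changing the number of variables does not
change the type; that only `x_0, …, x_q` occur is the condition `x_{q+1} ∉ N`, and since `x_q ^ t`
is the highest term of degree `t` in these variables, being full in degree `t` means
`x_q ^ t ∈ N`.

*The recursion* (`card_lexIdeals_succ_succ`). Split such a set `N` into its terms free of the last
variable and `x_last · N'`. Both parts are again of this kind. If the free part is full up to
degree `i` exactly, then `N` has no multiple of `x_last` in degrees above `i`, because these are
higher than a missing power of the preceding variable; so `N'` lives in degrees at most `i - 1`.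
Conversely any two such parts can be glued, because the free part is full in all degrees that
`x_last · N'` meets.

*Counting `O`-sequences* (`finiteOSequences_eq_image`). The terms that are not leading terms of a
homogeneous ideal `I` form an order ideal with the Hilbert function of the quotient, so what
remains is Macaulay's theorem that an order ideal has the Hilbert function of a lex-segment one.
The latter is unique, as its part of each degree is an initial segment of known size. In degree
`t + 1` Macaulay's theorem says that lex segments minimise the lower shadow among the sets of terms
of a given size (`shadowBound`). This goes by induction on the number of variables. Compressing in
pairs of variables makes a set `A` stable under replacing any factor by the lowest variable `x_i`
without enlarging the shadow (`exists_stable`). For stable sets multiplication by `x_i` identifies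
the shadow with the members divisible by `x_i`, so it suffices to bound the number of members free
of `x_i` (`card_slice_le_of_stable`). If a stable `A` had more of those than the lex segment `L`
of the same size, take the lex segment of equally many terms free of `x_i`, and all the terms up
to its last one. By the induction hypothesis, applied to each exponent of `x_i`, these are at most
`|A|` terms, although they properly contain `L`.
-/

namespace OSeq

section shadow

variable {ι : Type*} [LinearOrder ι]

/-! ### Lex segments and shadows -/

/-- The terms of degree `t` in the variables indexed by `S`. -/
def terms (S : Finset ι) (t : ℕ) : Finset (ι →₀ ℕ) := S.finsuppAntidiag t

theorem mem_terms {S : Finset ι} {t : ℕ} {σ : ι →₀ ℕ} :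
    σ ∈ terms S t ↔ σ.support ⊆ S ∧ σ.degree = t := by
  rw [terms, Finset.mem_finsuppAntidiag', and_comm]
  rfl

/-- `L` is an initial segment of `F` for the lexicographic order of the terms. -/
def IsInitial (F L : Finset (ι →₀ ℕ)) : Prop :=
  L ⊆ F ∧ ∀ τ ∈ L, ∀ σ ∈ F, toColex σ < toColex τ → σ ∈ L

theorem exists_isInitial_card (F : Finset (ι →₀ ℕ)) {m : ℕ} (hm : m ≤ F.card) :
    ∃ L, IsInitial F L ∧ L.card = m := by
  induction m with
  | zero => exact ⟨∅, ⟨by simp, by simp⟩, rfl⟩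
  | succ m ih =>
    obtain ⟨L, hL, hc⟩ := ih (by omega)
    have hne : (F \ L).Nonempty := by
      rw [← Finset.card_pos, Finset.card_sdiff_of_subset hL.1]; omega
    obtain ⟨a, ha, hmin⟩ := Finset.exists_min_image (F \ L) toColex hne
    rw [Finset.mem_sdiff] at ha
    refine ⟨insert a L, ⟨?_, ?_⟩, ?_⟩
    · exact Finset.insert_subset ha.1 hL.1
    · intro τ hτ σ hσ hlt
      by_contra hn
      rw [Finset.mem_insert, not_or] at hn
      rcases Finset.mem_insert.1 hτ with rfl | hτ
      · exact absurd (hmin σ (Finset.mem_sdiff.2 ⟨hσ, hn.2⟩)) (not_le.2 hlt)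
      · exact hn.2 (hL.2 τ hτ σ hσ hlt)
    · rw [Finset.card_insert_of_notMem ha.2, hc]

theorem IsInitial.subset_of_card_le {F L L' : Finset (ι →₀ ℕ)} (h : IsInitial F L)
    (h' : IsInitial F L') (hc : L.card ≤ L'.card) : L ⊆ L' := by
  intro a ha
  by_contra hn
  have : L' ⊂ L := by
    refine (Finset.ssubset_iff_of_subset fun b hb => ?_).2 ⟨a, ha, hn⟩
    rcases lt_trichotomy (toColex a) (toColex b) with hlt | heq | hlt
    · exact absurd (h'.2 b hb a (h.1 ha) hlt) hn
    · exact toColex_inj.1 heq ▸ ha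
    · exact h.2 a ha b (h'.1 hb) hlt
  exact absurd (Finset.card_lt_card this) (not_lt.2 hc)

open Classical in
/-- The lower shadow: the terms of degree `t` that divide a member of `A` of degree `t + 1`. -/
noncomputable def shadow (S : Finset ι) (t : ℕ) (A : Finset (ι →₀ ℕ)) : Finset (ι →₀ ℕ) :=
  (terms S t).filter fun σ => ∃ j, σ + Finsupp.single j 1 ∈ A

theorem mem_shadow {S : Finset ι} {t : ℕ} {A : Finset (ι →₀ ℕ)} {σ : ι →₀ ℕ} :
    σ ∈ shadow S t A ↔ σ ∈ terms S t ∧ ∃ j, σ + Finsupp.single j 1 ∈ A := by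
  simp [shadow]

theorem shadow_mono {S : Finset ι} {t : ℕ} {A B : Finset (ι →₀ ℕ)} (h : A ⊆ B) :
    shadow S t A ⊆ shadow S t B := by
  intro σ
  simp only [mem_shadow]
  rintro ⟨h1, j, hj⟩
  exact ⟨h1, j, h hj⟩

/-! ### Compression in two variables -/

theorem sum_range_card_le_sum (B : Finset ℕ) : ∑ b ∈ Finset.range B.card, b ≤ ∑ b ∈ B, b := by
  induction B using Finset.induction_on_max with
  | empty => simp
  | insert a s hs ih =>
    have ha : a ∉ s := fun h => lt_irrefl _ (hs a h)
    have hc : s.card ≤ a := by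
      simpa using Finset.card_le_card
        (fun x hx => Finset.mem_range.2 (hs x hx) : s ⊆ Finset.range a)
    rw [Finset.card_insert_of_notMem ha, Finset.sum_range_succ, Finset.sum_insert ha]
    omega

theorem sum_range_card_lt_sum {B : Finset ℕ} {b : ℕ} (hb : b ∉ B) (hb' : b + 1 ∈ B) :
    ∑ b ∈ Finset.range B.card, b < ∑ b ∈ B, b := by
  have hn : b ∉ B.erase (b + 1) := fun h => hb (Finset.mem_of_mem_erase h)
  have h := sum_range_card_le_sum (insert b (B.erase (b + 1)))
  rw [Finset.card_insert_of_notMem hn, Finset.card_erase_add_one hb', Finset.sum_insert hn] at h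
  have := Finset.add_sum_erase B (fun x => x) hb'
  omega

/-- The inequality behind the compression: the case of two variables of the shadow bound. -/
theorem card_le_or_le_card {B B' : Finset ℕ} {s : ℕ} (hB : B ⊆ Finset.range (s + 2))
    (h0 : ∀ b ∈ B, b ≤ s → b ∈ B') (h1 : ∀ b, b + 1 ∈ B → b ∈ B') :
    B.card ≤ B'.card ∨ s + 1 ≤ B'.card := by
  by_cases h : ∃ m ≤ s + 1, m ∉ B
  · left
    obtain ⟨m, hm, hmB⟩ := h
    -- Push the members of `B` above the gap `m` down by one.
    refine Finset.card_le_card_of_injOn (fun b => if b < m then b else b - 1) ?_ ?_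
    · intro b hb
      have hb : b ∈ B := hb
      have hne : b ≠ m := fun h => hmB (h ▸ hb)
      have := Finset.mem_range.1 (hB hb)
      dsimp only
      split_ifs with hlt
      · exact h0 b hb (by omega)
      · exact h1 _ (by rwa [Nat.sub_add_cancel (by omega)])
    · intro b hb c hc hbc
      have hb1 : b ≠ m := fun h => hmB (h ▸ hb)
      have hc1 : c ≠ m := fun h => hmB (h ▸ hc)
      dsimp only at hbc
      split_ifs at hbc <;> omega
  · right
    push Not at h
    have : Finset.range (s + 1) ⊆ B' := fun b hb => h0 b (h b (Finset.mem_range.1 hb).le)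
      (Nat.lt_succ_iff.1 (Finset.mem_range.1 hb))
    simpa using Finset.card_le_card this

/-- A term with the variables `i` and `j` removed. -/
noncomputable def rest (i j : ι) (τ : ι →₀ ℕ) : ι →₀ ℕ := (τ.erase i).erase j

/-- The term of degree `t` that has `b` as the exponent of `j` and becomes `u` when the variables
`i` and `j` are removed. -/
noncomputable def point (i j : ι) (t : ℕ) (u : ι →₀ ℕ) (b : ℕ) : ι →₀ ℕ :=
  u + Finsupp.single i (t - u.degree - b) + Finsupp.single j b

/-- The exponents of `j` in the terms of `A` of degree `t` lying over `u`. -/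
noncomputable def line (i j : ι) (t : ℕ) (A : Finset (ι →₀ ℕ)) (u : ι →₀ ℕ) : Finset ℕ :=
  (Finset.range (t - u.degree + 1)).filter fun b => point i j t u b ∈ A

/-- Compression of `A` in the variables `i`, `j`: over each `u`, the terms of `A` are replaced by
equally many, with the lowest exponents of `j`. -/
noncomputable def compress (i j : ι) (S : Finset ι) (t : ℕ) (A : Finset (ι →₀ ℕ)) :
    Finset (ι →₀ ℕ) :=
  (terms S t).filter fun τ => τ j < (line i j t A (rest i j τ)).card

section compress

variable {i j : ι} {S : Finset ι} {t : ℕ} {A : Finset (ι →₀ ℕ)}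

theorem rest_add_single_add_single (hij : i ≠ j) (τ : ι →₀ ℕ) :
    rest i j τ + Finsupp.single i (τ i) + Finsupp.single j (τ j) = τ := by
  ext k
  by_cases h1 : k = i
  · subst h1; simp [rest, hij, Finsupp.erase_ne, Finsupp.erase_same]
  · by_cases h2 : k = j
    · subst h2; simp [rest, h1]
    · simp [rest, h1, h2, Finsupp.erase_ne]

theorem degree_rest (hij : i ≠ j) (τ : ι →₀ ℕ) : (rest i j τ).degree + τ i + τ j = τ.degree := by
  conv_rhs => rw [← rest_add_single_add_single hij τ]
  simp

theorem point_rest (hij : i ≠ j) {τ : ι →₀ ℕ} (hτ : τ.degree = t) :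
    point i j t (rest i j τ) (τ j) = τ := by
  have := degree_rest hij τ
  rw [point, show t - (rest i j τ).degree - τ j = τ i by omega, rest_add_single_add_single hij]

theorem mem_rest_image (hij : i ≠ j) {u : ι →₀ ℕ} (hu : u ∈ (terms S t).image (rest i j)) :
    u i = 0 ∧ u j = 0 ∧ u.degree ≤ t ∧ u.support ⊆ S := by
  obtain ⟨τ, hτ, rfl⟩ := Finset.mem_image.1 hu
  have := degree_rest hij τ
  rw [mem_terms] at hτ
  refine ⟨?_, ?_, by omega, ?_⟩
  · simp [rest, hij, Finsupp.erase_ne]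
  · simp [rest]
  · refine subset_trans ?_ hτ.1
    simp only [rest, Finsupp.support_erase]
    exact (Finset.erase_subset _ _).trans (Finset.erase_subset _ _)

set_option linter.unusedSectionVars false in
theorem point_apply (hij : i ≠ j) {u : ι →₀ ℕ} (huj : u j = 0) (b : ℕ) :
    point i j t u b j = b := by
  simp [point, huj, hij]

theorem rest_point (hij : i ≠ j) {u : ι →₀ ℕ} (hui : u i = 0) (huj : u j = 0) (b : ℕ) :
    rest i j (point i j t u b) = u := by
  ext k
  by_cases h2 : k = j
  · subst h2; simp [rest, huj]
  · by_cases h1 : k = i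
    · subst h1; simp [rest, hij, Finsupp.erase_ne, hui]
    · simp [rest, point, h1, h2, Finsupp.erase_ne]

theorem point_mem_terms {u : ι →₀ ℕ} (hi : i ∈ S) (hj : j ∈ S) (hu : u.degree ≤ t)
    (hS : u.support ⊆ S) {b : ℕ} (hb : b < t - u.degree + 1) : point i j t u b ∈ terms S t := by
  rw [mem_terms]
  constructor
  · intro k hk
    by_contra hkS
    have h1 : k ≠ i := fun h => hkS (h ▸ hi)
    have h2 : k ≠ j := fun h => hkS (h ▸ hj)
    have h3 : u k = 0 := by
      by_contra h; exact hkS (hS (Finsupp.mem_support_iff.2 h))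
    simp [point, h1, h2, h3] at hk
  · simp only [point, map_add, Finsupp.degree_single]; omega

theorem rest_add_single_right (σ : ι →₀ ℕ) :
    rest i j (σ + Finsupp.single j 1) = rest i j σ := by
  ext k
  by_cases hk : k = j
  · subst hk; simp [rest]
  · by_cases hk' : k = i
    · subst hk'; simp [rest, hk, Finsupp.erase_ne, Finsupp.erase_same]
    · simp [rest, hk, hk', Finsupp.erase_ne]

theorem rest_add_single_left (σ : ι →₀ ℕ) :
    rest i j (σ + Finsupp.single i 1) = rest i j σ := by
  ext k
  by_cases hk : k = j
  · subst hk; simp [rest]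
  · by_cases hk' : k = i
    · subst hk'; simp [rest, hk, Finsupp.erase_ne, Finsupp.erase_same]
    · simp [rest, hk, hk', Finsupp.erase_ne]

theorem rest_add_single_of_ne {k : ι} (hki : k ≠ i) (hkj : k ≠ j) (σ : ι →₀ ℕ) :
    rest i j (σ + Finsupp.single k 1) = rest i j σ + Finsupp.single k 1 := by
  ext l
  by_cases h1 : l = j
  · subst h1; simp [rest, hkj]
  · by_cases h2 : l = i
    · subst h2; simp [rest, h1, hki, Finsupp.erase_ne]
    · simp [rest, h1, h2, Finsupp.erase_ne]

theorem sum_eq_sum_line (hij : i ≠ j) (hA : A ⊆ terms S t) (f : (ι →₀ ℕ) → ℕ) :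
    ∑ τ ∈ A, f τ = ∑ u ∈ (terms S t).image (rest i j),
      ∑ b ∈ line i j t A u, f (point i j t u b) := by
  rw [← Finset.sum_fiberwise_of_maps_to (g := rest i j) (t := (terms S t).image (rest i j))
    fun τ hτ => Finset.mem_image_of_mem _ (hA hτ)]
  refine Finset.sum_congr rfl fun u hu => ?_
  obtain ⟨h1, h2, h3, h4⟩ := mem_rest_image hij hu
  refine Finset.sum_bij' (fun τ _ => τ j) (fun b _ => point i j t u b) ?_ ?_ ?_ ?_ ?_
  · intro τ hτ
    obtain ⟨hτA, rfl⟩ := Finset.mem_filter.1 hτ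
    have ht := (mem_terms.1 (hA hτA)).2
    have := degree_rest hij τ
    refine Finset.mem_filter.2 ⟨Finset.mem_range.2 (by omega), ?_⟩
    rwa [point_rest hij ht]
  · intro b hb
    exact Finset.mem_filter.2 ⟨(Finset.mem_filter.1 hb).2, rest_point hij h1 h2 b⟩
  · intro τ hτ
    obtain ⟨hτA, rfl⟩ := Finset.mem_filter.1 hτ
    exact point_rest hij (mem_terms.1 (hA hτA)).2
  · intro b hb
    exact point_apply hij h2 b
  · intro τ hτ
    obtain ⟨hτA, rfl⟩ := Finset.mem_filter.1 hτ
    rw [point_rest hij (mem_terms.1 (hA hτA)).2]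

theorem card_line_le (u : ι →₀ ℕ) : (line i j t A u).card ≤ t - u.degree + 1 :=
  (Finset.card_filter_le _ _).trans_eq (Finset.card_range _)

theorem line_compress (hij : i ≠ j) (hi : i ∈ S) (hj : j ∈ S) {u : ι →₀ ℕ}
    (hu : u ∈ (terms S t).image (rest i j)) :
    line i j t (compress i j S t A) u = Finset.range (line i j t A u).card := by
  obtain ⟨h1, h2, h3, h4⟩ := mem_rest_image hij hu
  ext b
  have hle := card_line_le (i := i) (j := j) (t := t) (A := A) u
  rw [line, Finset.mem_filter, compress, Finset.mem_filter, rest_point hij h1 h2,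
    point_apply hij h2, Finset.mem_range, Finset.mem_range]
  constructor
  · exact fun h => h.2.2
  · exact fun h => ⟨by omega, point_mem_terms hi hj h3 h4 (by omega), h⟩

theorem compress_subset : compress i j S t A ⊆ terms S t := Finset.filter_subset _ _

theorem card_compress (hij : i ≠ j) (hi : i ∈ S) (hj : j ∈ S) (hA : A ⊆ terms S t) :
    (compress i j S t A).card = A.card := by
  rw [Finset.card_eq_sum_ones, Finset.card_eq_sum_ones, sum_eq_sum_line hij hA,
    sum_eq_sum_line hij compress_subset]
  refine Finset.sum_congr rfl fun u hu => ?_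
  rw [line_compress hij hi hj hu]
  simp

/-- The number of factors other than `i` in the terms of `A` drops under compression if some term
of `A` leaves `A` when a factor `j` is replaced by `i`. -/
theorem sum_compress_lt (hij : i ≠ j) (hi : i ∈ S) (hj : j ∈ S) (hA : A ⊆ terms S t)
    {σ : ι →₀ ℕ} (h1 : σ + Finsupp.single j 1 ∈ A) (h2 : σ + Finsupp.single i 1 ∉ A) :
    ∑ τ ∈ compress i j S t A, (τ.erase i).degree < ∑ τ ∈ A, (τ.erase i).degree := by
  have key : ∀ u ∈ (terms S t).image (rest i j), ∀ b,
      ((point i j t u b).erase i).degree = u.degree + b := by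
    intro u hu b
    have h := mem_rest_image hij hu
    have : (point i j t u b).erase i = u + Finsupp.single j b := by
      ext k
      by_cases hk : k = i
      · subst hk; simp [h.1, hij]
      · simp [point, hk, Finsupp.erase_ne]
    simp [this]
  rw [sum_eq_sum_line hij hA, sum_eq_sum_line hij compress_subset]
  have hrew : ∀ B : Finset (ι →₀ ℕ), ∑ u ∈ (terms S t).image (rest i j),
      ∑ b ∈ line i j t B u, ((point i j t u b).erase i).degree =
      ∑ u ∈ (terms S t).image (rest i j),
        ((line i j t B u).card * u.degree + ∑ b ∈ line i j t B u, b) := by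
    intro B
    refine Finset.sum_congr rfl fun u hu => ?_
    rw [Finset.sum_congr rfl fun b _ => key u hu b, Finset.sum_add_distrib]
    simp
  rw [hrew, hrew]
  have hd := (mem_terms.1 (hA h1)).2
  have hr1 := rest_add_single_right (i := i) (j := j) σ
  have hr2 := rest_add_single_left (i := i) (j := j) σ
  have hp1 := point_rest hij (t := t) hd
  have hp2 := point_rest hij (t := t) (τ := σ + Finsupp.single i 1) (by simpa using hd)
  have hdr := degree_rest hij σ
  rw [hr1] at hp1
  rw [hr2] at hp2
  simp only [Finsupp.add_apply, Finsupp.single_eq_same, map_add, Finsupp.degree_single] at hp1 hd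
  rw [Finsupp.add_apply, Finsupp.single_eq_of_ne hij.symm, add_zero] at hp2
  refine Finset.sum_lt_sum (fun u hu => ?_) ⟨rest i j σ, ?_, ?_⟩
  · rw [line_compress hij hi hj hu, Finset.card_range]
    exact Nat.add_le_add_left (sum_range_card_le_sum _) _
  · rw [← hr1]; exact Finset.mem_image_of_mem _ (hA h1)
  · rw [line_compress hij hi hj (by rw [← hr1]; exact Finset.mem_image_of_mem _ (hA h1)),
      Finset.card_range]
    refine Nat.add_lt_add_left (sum_range_card_lt_sum (b := σ j) ?_ ?_) _
    · rw [line, Finset.mem_filter, hp2]; exact fun h => h2 h.2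
    · rw [line, Finset.mem_filter, hp1, Finset.mem_range]; exact ⟨by omega, h1⟩

theorem shadow_compress_subset (hij : i ≠ j) (hi : i ∈ S) (hj : j ∈ S) :
    shadow S t (compress i j S (t + 1) A) ⊆ compress i j S t (shadow S t A) := by
  intro σ hσ
  obtain ⟨hσ, k, hk⟩ := mem_shadow.1 hσ
  refine Finset.mem_filter.2 ⟨hσ, ?_⟩
  have hlt := (Finset.mem_filter.1 hk).2
  have hd := degree_rest hij σ
  rw [(mem_terms.1 hσ).2] at hd
  obtain ⟨hu1, hu2, hu3, hu4⟩ := mem_rest_image hij (Finset.mem_image_of_mem (rest i j) hσ)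
  by_cases hkij : k = i ∨ k = j
  · have hu : rest i j (σ + Finsupp.single k 1) = rest i j σ := by
      rcases hkij with rfl | rfl
      exacts [rest_add_single_left σ, rest_add_single_right σ]
    rw [hu] at hlt
    have hle := card_line_le (i := i) (j := j) (t := t + 1) (A := A) (rest i j σ)
    have hcard := card_le_or_le_card (s := t - (rest i j σ).degree)
      (B := line i j (t + 1) A (rest i j σ)) (B' := line i j t (shadow S t A) (rest i j σ))
      (fun b hb => ?_) (fun b hb hbs => ?_) (fun b hb => ?_)
    · rcases hkij with rfl | rfl
      · simp only [Finsupp.add_apply, Finsupp.single_eq_of_ne hij.symm] at hlt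
        omega
      · simp only [Finsupp.add_apply, Finsupp.single_eq_same] at hlt
        omega
    · have := Finset.mem_range.1 (Finset.mem_filter.1 hb).1
      rw [Finset.mem_range]; omega
    · refine Finset.mem_filter.2 ⟨Finset.mem_range.2 (by omega), mem_shadow.2
        ⟨point_mem_terms hi hj hu3 hu4 (by omega), i, ?_⟩⟩
      convert (Finset.mem_filter.1 hb).2 using 1
      rw [point, point, show t + 1 - (rest i j σ).degree - b =
        t - (rest i j σ).degree - b + 1 by omega, Finsupp.single_add]
      abel
    · have := Finset.mem_range.1 (Finset.mem_filter.1 hb).1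
      refine Finset.mem_filter.2 ⟨Finset.mem_range.2 (by omega), mem_shadow.2
        ⟨point_mem_terms hi hj hu3 hu4 (by omega), j, ?_⟩⟩
      convert (Finset.mem_filter.1 hb).2 using 1
      rw [point, point, show t + 1 - (rest i j σ).degree - (b + 1) =
        t - (rest i j σ).degree - b by omega, Finsupp.single_add]
      abel
  · rw [not_or] at hkij
    rw [rest_add_single_of_ne hkij.1 hkij.2, Finsupp.add_apply,
      Finsupp.single_eq_of_ne (Ne.symm hkij.2), add_zero] at hlt
    refine hlt.trans_le (Finset.card_le_card fun b hb => ?_)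
    obtain ⟨hb, hb'⟩ := Finset.mem_filter.1 hb
    rw [Finset.mem_range, map_add, Finsupp.degree_single] at hb
    refine Finset.mem_filter.2 ⟨Finset.mem_range.2 (by omega), mem_shadow.2
      ⟨point_mem_terms hi hj hu3 hu4 (by omega), k, ?_⟩⟩
    convert hb' using 1
    rw [point, point, map_add, Finsupp.degree_single, Nat.add_sub_add_right]
    abel

/-- Every set of terms of degree `t + 1` can be replaced, without enlarging the shadow, by an
equally large one that is stable under replacing a factor by the variable `i`. -/
theorem exists_stable (hi : i ∈ S) (hA : A ⊆ terms S (t + 1)) :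
    ∃ A' ⊆ terms S (t + 1), A'.card = A.card ∧ (shadow S t A').card ≤ (shadow S t A).card ∧
      ∀ σ j, σ + Finsupp.single j 1 ∈ A' → σ + Finsupp.single i 1 ∈ A' := by
  induction hw : ∑ τ ∈ A, (τ.erase i).degree using Nat.strong_induction_on generalizing A with
  | _ w ih =>
    by_cases hst : ∀ σ j, σ + Finsupp.single j 1 ∈ A → σ + Finsupp.single i 1 ∈ A
    · exact ⟨A, hA, rfl, le_rfl, hst⟩
    · push Not at hst
      obtain ⟨σ, j, h1, h2⟩ := hst
      have hij : i ≠ j := fun h => h2 (h ▸ h1)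
      have hj : j ∈ S := (mem_terms.1 (hA h1)).1 (by simp)
      obtain ⟨A', hA', hc, hs, hst⟩ := ih _
        (hw ▸ sum_compress_lt hij hi hj hA h1 h2) compress_subset rfl
      refine ⟨A', hA', hc.trans (card_compress hij hi hj hA), hs.trans ?_, hst⟩
      refine (Finset.card_le_card (shadow_compress_subset hij hi hj)).trans_eq ?_
      exact card_compress hij hi hj fun σ hσ => (mem_shadow.1 hσ).1

end compress

/-! ### Macaulay's theorem -/

/-- The terms `ρ` of degree `s` in the variables `S` with `ρ · x_i ^ e ∈ A`. -/
noncomputable def slice (i : ι) (S : Finset ι) (A : Finset (ι →₀ ℕ)) (s e : ℕ) :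
    Finset (ι →₀ ℕ) :=
  (terms S s).filter fun ρ => ρ + Finsupp.single i e ∈ A

section macaulay

variable {i : ι} {S : Finset ι} {t : ℕ}

theorem apply_eq_zero_of_mem_terms (hi : i ∉ S) {ρ : ι →₀ ℕ} (h : ρ ∈ terms S t) : ρ i = 0 := by
  by_contra hne
  exact hi ((mem_terms.1 h).1 (Finsupp.mem_support_iff.2 hne))

theorem card_eq_sum_card_slice (hi : i ∉ S) {A : Finset (ι →₀ ℕ)} (hA : A ⊆ terms (insert i S) t) :
    A.card = ∑ x ∈ Finset.HasAntidiagonal.antidiagonal t, (slice i S A x.1 x.2).card := by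
  rw [Finset.card_eq_sum_card_fiberwise (f := fun τ => (t - τ i, τ i))
    (t := Finset.HasAntidiagonal.antidiagonal t)]
  · refine Finset.sum_congr rfl fun ⟨s, e⟩ hx => ?_
    rw [Finset.HasAntidiagonal.mem_antidiagonal] at hx
    dsimp only at hx ⊢
    refine Finset.card_bij' (fun τ _ => τ.erase i) (fun ρ _ => ρ + Finsupp.single i e) ?_ ?_ ?_ ?_
    · intro τ hτ
      obtain ⟨hτA, hx⟩ := Finset.mem_filter.1 hτ
      obtain rfl : τ i = e := (Prod.ext_iff.1 hx).2
      have h := Finsupp.erase_add_single i τ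
      have h' := congrArg Finsupp.degree h
      obtain ⟨h1, h2⟩ := mem_terms.1 (hA hτA)
      simp only [map_add, Finsupp.degree_single] at h'
      refine Finset.mem_filter.2 ⟨mem_terms.2 ⟨?_, by omega⟩, h.symm ▸ hτA⟩
      rw [Finsupp.support_erase]
      exact fun k hk => (Finset.mem_insert.1 (h1 (Finset.mem_of_mem_erase hk))).resolve_left
        (Finset.ne_of_mem_erase hk)
    · intro ρ hρ
      obtain ⟨hρ, hρA⟩ := Finset.mem_filter.1 hρ
      refine Finset.mem_filter.2 ⟨hρA, ?_⟩
      have := apply_eq_zero_of_mem_terms hi hρ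
      ext <;> simp [this]; omega
    · intro τ hτ
      obtain ⟨hτ, hx⟩ := Finset.mem_filter.1 hτ
      obtain rfl : τ i = e := (Prod.ext_iff.1 hx).2
      exact Finsupp.erase_add_single i τ
    · intro ρ hρ
      have := apply_eq_zero_of_mem_terms hi (Finset.mem_filter.1 hρ).1
      ext k
      by_cases hk : k = i
      · subst hk; simp [this]
      · simp [Finsupp.erase_ne hk]
  · intro τ hτ
    have h := (mem_terms.1 (hA hτ)).2
    have := Finsupp.le_degree i τ
    rw [Finset.mem_coe, Finset.HasAntidiagonal.mem_antidiagonal]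
    dsimp only
    omega

theorem card_filter_apply_eq_zero (hi : i ∉ S) {A : Finset (ι →₀ ℕ)}
    (hA : A ⊆ terms (insert i S) t) : A.filter (fun τ => τ i = 0) = slice i S A t 0 := by
  ext τ
  simp only [slice, Finset.mem_filter, Finsupp.single_zero, add_zero]
  constructor
  · rintro ⟨h, h0⟩
    obtain ⟨h1, h2⟩ := mem_terms.1 (hA h)
    refine ⟨mem_terms.2 ⟨fun k hk => (Finset.mem_insert.1 (h1 hk)).resolve_left ?_, h2⟩, h⟩
    rintro rfl
    exact (Finsupp.mem_support_iff.1 hk) h0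
  · exact fun h => ⟨h.2, apply_eq_zero_of_mem_terms hi h.1⟩

/-- Trading a factor `x_i`, the lowest variable, for the second lowest variable `x_j` keeps a term
below `τ` when `τ` is free of `x_i`. -/
theorem add_single_le_of_le {j : ι} (hi : ∀ k ∈ S, i < k) (hj : ∀ k ∈ S, j ≤ k) (hjS : j ∈ S)
    {τ ρ : ι →₀ ℕ} {s e : ℕ} (hτ : τ ∈ terms S (s + (e + 1))) (hρ : ρ ∈ terms S s)
    (hle : toColex (ρ + Finsupp.single i (e + 1)) ≤ toColex τ) :
    toColex (ρ + Finsupp.single j 1 + Finsupp.single i e) ≤ toColex τ := by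
  have hiS : i ∉ S := fun h => lt_irrefl _ (hi i h)
  have hτi := apply_eq_zero_of_mem_terms hiS hτ
  have hji : j ≠ i := (hi j hjS).ne'
  rcases hle.eq_or_lt with heq | hlt
  · have := DFunLike.congr_fun (toColex_inj.1 heq) i
    simp [hτi] at this
  · obtain ⟨k, hk, hk'⟩ := Finsupp.Colex.lt_iff.1 hlt
    simp only [ofColex_toColex] at hk hk'
    have hkS : k ∈ S := (mem_terms.1 hτ).1 (Finsupp.mem_support_iff.2 (by omega))
    have hval : ∀ l, k < l → ρ l = τ l := by
      intro l hl
      have := hk l hl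
      rwa [Finsupp.add_apply, Finsupp.single_eq_of_ne ((hi k hkS).trans hl).ne', add_zero] at this
    rw [Finsupp.add_apply, Finsupp.single_eq_of_ne (hi k hkS).ne', add_zero] at hk'
    have hval' : ∀ l, k < l →
        (ρ + Finsupp.single j 1 + Finsupp.single i e : ι →₀ ℕ) l = τ l := by
      intro l hl
      simp [hval l hl, ((hj k hkS).trans_lt hl).ne', ((hi k hkS).trans hl).ne']
    by_cases hkj : k = j ∧ ρ j + 1 = τ j
    · obtain ⟨rfl, hkj⟩ := hkj
      -- The two terms now agree outside `i`, and comparing degrees gives `e = 0`.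
      have heq : ρ + Finsupp.single k 1 = τ := by
        ext l
        rcases lt_trichotomy l k with hl | rfl | hl
        · have hlS : l ∉ S := fun h => absurd (hj l h) (not_le.2 hl)
          simp [hl.ne, apply_eq_zero_of_mem_terms hlS hτ, apply_eq_zero_of_mem_terms hlS hρ]
        · simpa using hkj
        · simp [hl.ne', hval l hl]
      have hd := congrArg Finsupp.degree heq
      rw [map_add, Finsupp.degree_single, (mem_terms.1 hτ).2, (mem_terms.1 hρ).2] at hd
      obtain rfl : e = 0 := by omega
      simp [heq]
    · refine le_of_lt (Finsupp.Colex.lt_iff.2 ⟨k, hval', ?_⟩)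
      simp only [ofColex_toColex, Finsupp.add_apply, Finsupp.single_eq_of_ne (hi k hkS).ne',
        add_zero]
      by_cases h : k = j
      · subst h; simp at hkj ⊢; omega
      · simpa [h] using hk'

/-- The inductive form of Macaulay's theorem: lex segments have the smallest lower shadow. -/
def ShadowBound (S : Finset ι) : Prop :=
  ∀ t, ∀ A L : Finset (ι →₀ ℕ), A ⊆ terms S (t + 1) → IsInitial (terms S (t + 1)) L →
    L.card ≤ A.card → (shadow S t L).card ≤ (shadow S t A).card

/-- Among the sets of terms of a given size that are stable under replacing a factor by the lowest
variable `i`, lex segments have the most terms free of `i`. -/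
theorem card_slice_le_of_stable (hi : ∀ k ∈ S, i < k) (hS : ShadowBound S)
    {A L : Finset (ι →₀ ℕ)} (hA : A ⊆ terms (insert i S) t)
    (hst : ∀ σ j, σ + Finsupp.single j 1 ∈ A → σ + Finsupp.single i 1 ∈ A)
    (hL : IsInitial (terms (insert i S) t) L) (hc : L.card = A.card) :
    (slice i S A t 0).card ≤ (slice i S L t 0).card := by
  have hiS : i ∉ S := fun h => lt_irrefl _ (hi i h)
  have hins : ∀ {s e : ℕ} {ρ : ι →₀ ℕ}, ρ ∈ terms S s →
      ρ + Finsupp.single i e ∈ terms (insert i S) (s + e) := by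
    intro s e ρ hρ
    obtain ⟨h1, h2⟩ := mem_terms.1 hρ
    refine mem_terms.2 ⟨fun k hk => ?_, by simp [h2]⟩
    by_cases hki : k = i
    · simp [hki]
    · refine Finset.mem_insert_of_mem (h1 ?_)
      simpa [hki] using hk
  by_contra! hlt
  -- A lex segment `B` as large as the `i`-free part of `A` has a member `τ` outside `L`.
  obtain ⟨B, hB, hBc⟩ := exists_isInitial_card (terms S t)
    (Finset.card_le_card (Finset.filter_subset _ _) : (slice i S A t 0).card ≤ _)
  obtain ⟨τ, hτB, hτL⟩ : ∃ τ ∈ B, τ ∉ L := by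
    by_contra! h
    refine absurd (Finset.card_le_card (fun τ hτ => ?_ : B ⊆ slice i S L t 0)) (by omega)
    exact Finset.mem_filter.2 ⟨hB.1 hτ, by simpa using h τ hτ⟩
  have hτ := hB.1 hτB
  set T := (terms (insert i S) t).filter fun σ => toColex σ ≤ toColex τ with hT
  have hLT : L ⊂ T := by
    have hτt : τ ∈ terms (insert i S) t := by simpa using hins (e := 0) hτ
    refine (Finset.ssubset_iff_of_subset fun σ hσ => ?_).2
      ⟨τ, Finset.mem_filter.2 ⟨hτt, le_rfl⟩, hτL⟩
    refine Finset.mem_filter.2 ⟨hL.1 hσ, ?_⟩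
    by_contra! hn
    exact hτL (hL.2 σ hσ τ hτt hn)
  refine absurd (Finset.card_lt_card hLT) (not_lt.2 ?_)
  rw [hc, card_eq_sum_card_slice hiS (Finset.filter_subset _ _ : T ⊆ _),
    card_eq_sum_card_slice hiS hA]
  suffices key : ∀ e s, s + e = t → (slice i S T s e).card ≤ (slice i S A s e).card from
    Finset.sum_le_sum fun x hx => key x.2 x.1 (Finset.HasAntidiagonal.mem_antidiagonal.1 hx)
  intro e
  induction e with
  | zero =>
    intro s hs
    obtain rfl : s = t := by simpa using hs
    rw [← hBc]
    refine Finset.card_le_card fun ρ hρ => ?_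
    obtain ⟨hρ, hρT⟩ := Finset.mem_filter.1 hρ
    have hle := (Finset.mem_filter.1 hρT).2
    rw [Finsupp.single_zero, add_zero] at hle
    rcases hle.eq_or_lt with heq | hlt
    · rw [toColex_inj.1 heq]; exact hτB
    · exact hB.2 τ hτB ρ hρ hlt
  | succ e ih =>
    intro s hs
    rcases S.eq_empty_or_nonempty with rfl | hne
    · have h1 := mem_terms.1 hτ
      have h2 : τ = 0 := by simpa using h1.1
      rw [h2] at h1
      have := h1.2
      simp at this
      omega
    have hjS := S.min'_mem hne
    have hinit : IsInitial (terms S (s + 1)) (slice i S T (s + 1) e) := by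
      refine ⟨Finset.filter_subset _ _, fun ρ hρ σ hσ hlt => ?_⟩
      refine Finset.mem_filter.2 ⟨hσ, Finset.mem_filter.2 ⟨?_, ?_⟩⟩
      · convert hins (e := e) hσ using 1
        congr 1; omega
      · refine le_trans ?_ (Finset.mem_filter.1 (Finset.mem_filter.1 hρ).2).2
        rw [toColex_add, toColex_add]
        exact add_le_add_left hlt.le _
    refine le_trans (Finset.card_le_card fun ρ hρ => ?_)
      ((hS s _ _ (Finset.filter_subset _ _) hinit (ih (s + 1) (by omega))).trans
        (Finset.card_le_card fun ρ hρ => ?_))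
    · obtain ⟨hρ, hρT⟩ := Finset.mem_filter.1 hρ
      have hρj : ρ + Finsupp.single (S.min' hne) 1 ∈ terms S (s + 1) := by
        obtain ⟨h1, h2⟩ := mem_terms.1 hρ
        refine mem_terms.2 ⟨fun k hk => ?_, by simp [h2]⟩
        rcases Finset.mem_union.1 (Finsupp.support_add hk) with h | h
        · exact h1 h
        · rw [Finset.mem_singleton.1 (Finsupp.support_single_subset h)]; exact hjS
      refine mem_shadow.2 ⟨hρ, S.min' hne, Finset.mem_filter.2 ⟨hρj,
        Finset.mem_filter.2 ⟨?_, ?_⟩⟩⟩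
      · convert hins (e := e) hρj using 1
        congr 1; omega
      · refine add_single_le_of_le hi (fun k hk => S.min'_le k hk) hjS (s := s) ?_ hρ
          (Finset.mem_filter.1 hρT).2
        rwa [hs]
    · obtain ⟨hρ, k, hk⟩ := mem_shadow.1 hρ
      refine Finset.mem_filter.2 ⟨hρ, ?_⟩
      have h := (Finset.mem_filter.1 hk).2
      rw [add_right_comm] at h
      have h := hst _ _ h
      rwa [add_assoc, ← Finsupp.single_add] at h

theorem card_shadow_of_stable (hi : i ∉ S) {A : Finset (ι →₀ ℕ)}
    (hA : A ⊆ terms (insert i S) (t + 1))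
    (hst : ∀ σ j, σ + Finsupp.single j 1 ∈ A → σ + Finsupp.single i 1 ∈ A) :
    (shadow (insert i S) t A).card + (slice i S A (t + 1) 0).card = A.card := by
  rw [← card_filter_apply_eq_zero hi hA, add_comm,
    ← Finset.card_filter_add_card_filter_not (s := A) (fun τ => τ i = 0)]
  congr 1
  refine Finset.card_bij' (fun σ _ => σ + Finsupp.single i 1) (fun τ _ => τ - Finsupp.single i 1)
    ?_ ?_ ?_ ?_
  · intro σ hσ
    obtain ⟨hσ, k, hk⟩ := mem_shadow.1 hσ
    exact Finset.mem_filter.2 ⟨hst σ k hk, by simp⟩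
  · intro τ hτ
    obtain ⟨hτ, hτi⟩ := Finset.mem_filter.1 hτ
    have hadd : τ - Finsupp.single i 1 + Finsupp.single i 1 = τ :=
      tsub_add_cancel_of_le (Finsupp.single_le_iff.2 (Nat.one_le_iff_ne_zero.2 hτi))
    have hd := congrArg Finsupp.degree hadd
    obtain ⟨h1, h2⟩ := mem_terms.1 (hA hτ)
    rw [map_add, Finsupp.degree_single, h2] at hd
    refine mem_shadow.2 ⟨mem_terms.2 ⟨fun k hk => h1 ?_, by omega⟩, i, hadd.symm ▸ hτ⟩
    rw [Finsupp.mem_support_iff] at hk ⊢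
    rw [Finsupp.tsub_apply] at hk
    omega
  · intro σ hσ
    exact add_tsub_cancel_right _ _
  · intro τ hτ
    exact tsub_add_cancel_of_le
      (Finsupp.single_le_iff.2 (Nat.one_le_iff_ne_zero.2 (Finset.mem_filter.1 hτ).2))

theorem IsInitial.stable (hi : ∀ k ∈ S, i < k) {L : Finset (ι →₀ ℕ)}
    (hL : IsInitial (terms (insert i S) t) L) (σ : ι →₀ ℕ) (j : ι)
    (h : σ + Finsupp.single j 1 ∈ L) : σ + Finsupp.single i 1 ∈ L := by
  obtain ⟨h1, h2⟩ := mem_terms.1 (hL.1 h)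
  have hj : j ∈ insert i S := h1 (by simp)
  rcases Finset.mem_insert.1 hj with rfl | hj
  · exact h
  · refine hL.2 _ h _ (mem_terms.2 ⟨fun k hk => ?_, by simpa using h2⟩) ?_
    · by_cases hki : k = i
      · simp [hki]
      · refine h1 ?_
        rw [Finsupp.mem_support_iff] at hk ⊢
        rw [Finsupp.add_apply, Finsupp.single_eq_of_ne hki] at hk
        rw [Finsupp.add_apply]
        omega
    · rw [toColex_add, toColex_add]
      exact add_lt_add_right (Finsupp.Colex.single_lt_iff.2 (hi j hj)) _

/-- **Macaulay's theorem** on lower shadows of sets of terms. -/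
theorem shadowBound (S : Finset ι) : ShadowBound S := by
  induction S using Finset.induction_on_min with
  | empty =>
    intro t A L _ hL _
    have : L = ∅ := by
      rw [Finset.eq_empty_iff_forall_notMem]
      intro σ hσ
      have h := mem_terms.1 (hL.1 hσ)
      have h2 : σ = 0 := by simpa using h.1
      simp [h2] at h
    subst this
    have : shadow (∅ : Finset ι) t ∅ = ∅ := by
      rw [Finset.eq_empty_iff_forall_notMem]
      intro σ hσ
      obtain ⟨_, j, hj⟩ := mem_shadow.1 hσ
      simp at hj
    simp [this]
  | insert i S hi ih =>
    intro t A L hA hL hc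
    have hiS : i ∉ S := fun h => lt_irrefl _ (hi i h)
    obtain ⟨A', hA', hAc, hs, hst⟩ := exists_stable (Finset.mem_insert_self i S) hA
    refine le_trans ?_ hs
    obtain ⟨L', hL', hLc⟩ := exists_isInitial_card _ (Finset.card_le_card hA')
    refine (Finset.card_le_card
      (shadow_mono (hL.subset_of_card_le hL' (by omega)))).trans ?_
    have h1 := card_shadow_of_stable hiS hA' hst
    have h2 := card_shadow_of_stable hiS hL'.1 (hL'.stable hi)
    have h3 := card_slice_le_of_stable hi ih hA' hst hL' hLc
    omega

end macaulay

end shadow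

open Finsupp (single)

/-! ### Lex-segment order ideals of terms -/

/-- A finite order ideal of terms, in any number of the variables `x_0 < x_1 < ⋯`, that contains
with each term all lexicographically lower terms of the same degree. -/
structure IsLexOrderIdeal (N : Finset (ℕ →₀ ℕ)) : Prop where
  lower : ∀ σ τ, σ ≤ τ → τ ∈ N → σ ∈ N
  lex : ∀ σ τ, σ.degree = τ.degree → toColex σ < toColex τ → τ ∈ N → σ ∈ N

section order

variable {q m : ℕ} {σ τ : ℕ →₀ ℕ}

theorem eq_single_zero (h : ∀ k, 1 ≤ k → τ k = 0) : τ = single 0 (τ 0) := by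
  ext k
  rcases Nat.eq_zero_or_pos k with rfl | hk
  · simp
  · simp [h k hk, hk.ne']

/-- In the variables up to `x_q`, the power of `x_q` is the highest term of its degree. -/
theorem colex_le_single (h : ∀ k, q < k → σ k = 0) :
    toColex σ ≤ toColex (single q σ.degree) := by
  rcases (Finsupp.le_degree q σ).eq_or_lt with heq | hlt
  · have h2 : single q (σ q) + (σ - single q (σ q)) = σ :=
      add_tsub_cancel_of_le (Finsupp.single_le_iff.2 le_rfl)
    have h3 := congrArg Finsupp.degree h2
    rw [map_add, Finsupp.degree_single, heq, Nat.add_eq_left, Finsupp.degree_eq_zero_iff] at h3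
    rw [← heq] at h3
    rw [h3, add_zero, heq] at h2
    rw [h2]
  · exact le_of_lt (Finsupp.Colex.lt_iff.2
      ⟨q, fun k hk => by simp [h k hk, hk.ne], by simpa using hlt⟩)

/-- Powers of `x_q` are lower than the terms of the same degree that involve a later variable. -/
theorem single_colex_lt {k : ℕ} (hk : q < k) (hτ : τ k ≠ 0) :
    toColex (single q τ.degree) < toColex τ := by
  refine lt_of_not_ge fun hle => ?_
  rcases hle.eq_or_lt with heq | hlt
  · have := toColex_inj.1 heq
    apply hτ
    rw [this, Finsupp.single_eq_of_ne hk.ne']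
  · obtain ⟨l, h1, h2⟩ := Finsupp.Colex.lt_iff.1 hlt
    simp only [ofColex_toColex] at h1 h2
    have hl : l = q := by
      by_contra hne
      simp [hne] at h2
    subst hl
    have := h1 k hk
    simp [hk.ne'] at this
    exact hτ this

theorem apply_eq_zero_of_colex_lt (hlt : toColex σ < toColex τ) (h : ∀ k, m ≤ k → τ k = 0) :
    ∀ k, m ≤ k → σ k = 0 := by
  obtain ⟨l, h1, h2⟩ := Finsupp.Colex.lt_iff.1 hlt
  simp only [ofColex_toColex] at h1 h2
  have hl : l < m := by
    by_contra! hl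
    rw [h l hl] at h2
    omega
  exact fun k hk => (h1 k (by omega)).trans (h k hk)

end order

namespace IsLexOrderIdeal

variable {N : Finset (ℕ →₀ ℕ)} {q m t : ℕ} {σ τ : ℕ →₀ ℕ}

theorem zero_mem (hN : IsLexOrderIdeal N) (hτ : τ ∈ N) : 0 ∈ N :=
  hN.lower 0 τ zero_le hτ

theorem mem_of_colex_le (hN : IsLexOrderIdeal N) (hd : σ.degree = τ.degree)
    (hle : toColex σ ≤ toColex τ) (hτ : τ ∈ N) : σ ∈ N := by
  rcases hle.eq_or_lt with heq | hlt
  · rwa [toColex_inj.1 heq]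
  · exact hN.lex σ τ hd hlt hτ

theorem single_mem_of_le (hN : IsLexOrderIdeal N) {a b : ℕ} (hab : a ≤ b) (h : single q b ∈ N) :
    single q a ∈ N :=
  hN.lower _ _ (Finsupp.single_mono hab) h

theorem single_mem_of_var_le (hN : IsLexOrderIdeal N) (hqm : q ≤ m) (h : single m t ∈ N) :
    single q t ∈ N := by
  refine hN.mem_of_colex_le (by simp) ?_ h
  have := colex_le_single (q := m) (σ := single q t)
    fun k hk => Finsupp.single_eq_of_ne (by omega)
  rwa [Finsupp.degree_single] at this

theorem apply_eq_zero (hN : IsLexOrderIdeal N) (hm : single m 1 ∉ N) (hτ : τ ∈ N) (k : ℕ)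
    (hk : m ≤ k) : τ k = 0 := by
  by_contra h
  exact hm (hN.single_mem_of_var_le hk
    (hN.lower _ _ (Finsupp.single_le_iff.2 (Nat.one_le_iff_ne_zero.2 h)) hτ))

theorem mem_of_single_mem (hN : IsLexOrderIdeal N) (h : single q t ∈ N) (hσ : σ.degree ≤ t)
    (hz : ∀ k, q < k → σ k = 0) : σ ∈ N :=
  hN.mem_of_colex_le (by simp) (colex_le_single hz) (hN.single_mem_of_le hσ h)

theorem single_mem_of_apply_ne_zero (hN : IsLexOrderIdeal N) (hτ : τ ∈ N) {k : ℕ} (hk : q < k)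
    (h : τ k ≠ 0) : single q τ.degree ∈ N :=
  hN.lex _ τ (by simp) (single_colex_lt hk h) hτ

theorem single_zero_degree_mem (hN : IsLexOrderIdeal N) (hτ : τ ∈ N) :
    single 0 τ.degree ∈ N := by
  by_cases h : ∀ k, 0 < k → τ k = 0
  · have h1 := eq_single_zero h
    rw [h1, Finsupp.degree_single, ← h1]
    exact hτ
  · push Not at h
    obtain ⟨k, hk, hne⟩ := h
    exact hN.single_mem_of_apply_ne_zero hτ hk hne

theorem lt_card_of_single_mem (hN : IsLexOrderIdeal N) (h : single q t ∈ N) : t < N.card := by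
  have hsub : (Finset.range (t + 1)).image (fun b => (single q b : ℕ →₀ ℕ)) ⊆ N := by
    intro τ hτ
    obtain ⟨b, hb, rfl⟩ := Finset.mem_image.1 hτ
    exact hN.single_mem_of_le (Nat.lt_succ_iff.1 (Finset.mem_range.1 hb)) h
  have := Finset.card_le_card hsub
  rwa [Finset.card_image_of_injective _ (Finsupp.single_injective q), Finset.card_range] at this

theorem lt_card_of_single_one_mem (hN : IsLexOrderIdeal N) (h : single q 1 ∈ N) :
    q + 1 < N.card := by
  have hsub : (Finset.range (q + 1)).image (fun b => (single b 1 : ℕ →₀ ℕ)) ⊆ N.erase 0 := by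
    intro τ hτ
    obtain ⟨b, hb, rfl⟩ := Finset.mem_image.1 hτ
    exact Finset.mem_erase.2 ⟨by simp,
      hN.single_mem_of_var_le (Nat.lt_succ_iff.1 (Finset.mem_range.1 hb)) h⟩
  have := Finset.card_le_card hsub
  rw [Finset.card_image_of_injective _ (Finsupp.single_left_injective one_ne_zero),
    Finset.card_range] at this
  have := Finset.card_erase_add_one (hN.zero_mem h)
  omega

theorem exists_top (hN : IsLexOrderIdeal N) (h0 : 0 ∈ N) (q : ℕ) :
    ∃ k, single q k ∈ N ∧ single q (k + 1) ∉ N := by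
  by_contra! h
  have : ∀ k, single q k ∈ N := by
    intro k
    induction k with
    | zero => simpa using h0
    | succ k ih => exact h k ih
  exact lt_irrefl _ (hN.lt_card_of_single_mem (this N.card))

theorem le_of_single_mem (hN : IsLexOrderIdeal N) {a b : ℕ} (ha : single q a ∈ N)
    (hb : single q (b + 1) ∉ N) : a ≤ b := by
  by_contra! h
  exact hb (hN.single_mem_of_le h ha)

end IsLexOrderIdeal

open Classical in
/-- The lex-segment order ideals in the variables `x_0, …, x_q` with `d` members, of degrees at
most `n`, that contain all terms of degree at most `k` in these variables, but not all those of
degree `k + 1`. By lex-closedness the latter is a condition on the powers of `x_q`. -/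
noncomputable def lexIdeals (q n k d : ℕ) : Finset (Finset (ℕ →₀ ℕ)) :=
  ((Finset.range (n + 1)).biUnion (terms (Finset.range (q + 1)))).powerset.filter fun N =>
    IsLexOrderIdeal N ∧ N.card = d ∧ (∀ τ ∈ N, τ.degree ≤ n) ∧ single (q + 1) 1 ∉ N ∧
      single q k ∈ N ∧ single q (k + 1) ∉ N

theorem mem_lexIdeals {q n k d : ℕ} {N : Finset (ℕ →₀ ℕ)} :
    N ∈ lexIdeals q n k d ↔ IsLexOrderIdeal N ∧ N.card = d ∧ (∀ τ ∈ N, τ.degree ≤ n) ∧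
      single (q + 1) 1 ∉ N ∧ single q k ∈ N ∧ single q (k + 1) ∉ N := by
  classical
  rw [lexIdeals, Finset.mem_filter, and_iff_right_iff_imp, Finset.mem_powerset]
  rintro ⟨hN, -, hn, hq, -⟩ τ hτ
  refine Finset.mem_biUnion.2 ⟨τ.degree, Finset.mem_range.2 (Nat.lt_succ_iff.2 (hn τ hτ)),
    mem_terms.2 ⟨fun k hk => ?_, rfl⟩⟩
  by_contra h
  exact (Finsupp.mem_support_iff.1 hk) (hN.apply_eq_zero hq hτ k (by simpa using h))

/-! ### The recursion -/

theorem isLexOrderIdeal_image_single (k : ℕ) :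
    IsLexOrderIdeal ((Finset.range k).image fun b => (single 0 b : ℕ →₀ ℕ)) where
  lower := by
    intro σ τ hle hτ
    obtain ⟨b, hb, rfl⟩ := Finset.mem_image.1 hτ
    have h0 := hle 0
    rw [Finsupp.single_eq_same] at h0
    rw [eq_single_zero (τ := σ) fun l hl => ?_]
    · exact Finset.mem_image_of_mem _ (Finset.mem_range.2 (h0.trans_lt (Finset.mem_range.1 hb)))
    · have := hle l
      rwa [Finsupp.single_eq_of_ne (by omega), Nat.le_zero] at this
  lex := by
    intro σ τ hd hlt hτ
    obtain ⟨b, hb, rfl⟩ := Finset.mem_image.1 hτ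
    have h := eq_single_zero (apply_eq_zero_of_colex_lt (m := 1) hlt
      fun l hl => Finsupp.single_eq_of_ne (by omega))
    rw [h, Finsupp.degree_single, Finsupp.degree_single] at hd
    rwa [h, hd]

theorem card_lexIdeals_zero (n k d : ℕ) :
    (lexIdeals 0 n k d).card = if k + 1 = d ∧ d ≤ n + 1 then 1 else 0 := by
  set P := (Finset.range (k + 1)).image fun b => (single 0 b : ℕ →₀ ℕ) with hP
  have hPc : P.card = k + 1 := by
    rw [hP, Finset.card_image_of_injective _ (Finsupp.single_injective 0), Finset.card_range]
  have hmem : ∀ {τ : ℕ →₀ ℕ}, τ ∈ P ↔ ∃ b, b < k + 1 ∧ single 0 b = τ := by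
    intro τ; simp [hP]
  have huniq : ∀ N ∈ lexIdeals 0 n k d, N = P := by
    intro N hN
    obtain ⟨hN, -, -, h1, h2, h3⟩ := mem_lexIdeals.1 hN
    ext τ
    rw [hmem]
    constructor
    · intro hτ
      have h := eq_single_zero (hN.apply_eq_zero h1 hτ)
      refine ⟨τ 0, Nat.lt_succ_iff.2 (hN.le_of_single_mem (h ▸ hτ) h3), h.symm⟩
    · rintro ⟨b, hb, rfl⟩
      exact hN.single_mem_of_le (Nat.lt_succ_iff.1 hb) h2
  split_ifs with h
  · rw [Finset.card_eq_one]
    refine ⟨P, Finset.eq_singleton_iff_unique_mem.2 ⟨mem_lexIdeals.2 ?_, huniq⟩⟩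
    refine ⟨isLexOrderIdeal_image_single _, by omega, ?_, ?_, ?_, ?_⟩
    · intro τ hτ
      obtain ⟨b, hb, rfl⟩ := hmem.1 hτ
      rw [Finsupp.degree_single]; omega
    · rw [hmem]
      rintro ⟨b, -, hb⟩
      have := DFunLike.congr_fun hb 1
      simp at this
    · exact hmem.2 ⟨k, by omega, rfl⟩
    · rw [hmem]
      rintro ⟨b, hb, hb'⟩
      have := Finsupp.single_injective 0 hb'
      omega
  · rw [Finset.card_eq_zero, Finset.eq_empty_iff_forall_notMem]
    intro N hN
    have := huniq N hN
    obtain ⟨-, h1, h2, -, h3, -⟩ := mem_lexIdeals.1 hN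
    have := h2 _ h3
    rw [Finsupp.degree_single] at this
    subst N
    omega

/-- An order ideal that is not full in degree `1` does not contain the last variable, so it is one
in a variable less. -/
theorem card_lexIdeals_succ_zero (q n d : ℕ) :
    (lexIdeals (q + 1) n 0 d).card = ∑ k ∈ Finset.range d, (lexIdeals q n k d).card := by
  classical
  rw [← Finset.card_biUnion]
  · congr 1
    ext N
    simp only [Finset.mem_biUnion, Finset.mem_range, mem_lexIdeals]
    constructor
    · rintro ⟨hN, hd, hn, h1, h2, h3⟩
      obtain ⟨k, hk, hk'⟩ := hN.exists_top (hN.zero_mem h2) q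
      exact ⟨k, hd ▸ hN.lt_card_of_single_mem hk, hN, hd, hn, h3, hk, hk'⟩
    · rintro ⟨k, -, hN, hd, hn, h1, h2, h3⟩
      exact ⟨hN, hd, hn, fun h => h1 (hN.single_mem_of_var_le (Nat.le_succ _) h),
        by simpa using hN.zero_mem h2, h1⟩
  · intro k _ k' _ hne
    refine Finset.disjoint_left.2 fun N hN hN' => hne ?_
    obtain ⟨hN, -, -, -, h2, h3⟩ := mem_lexIdeals.1 hN
    obtain ⟨-, -, -, -, h2', h3'⟩ := mem_lexIdeals.1 hN'
    exact le_antisymm (hN.le_of_single_mem h2 h3') (hN.le_of_single_mem h2' h3)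

/-- The members of `N` that are free of `x_m`. -/
def freePart (m : ℕ) (N : Finset (ℕ →₀ ℕ)) : Finset (ℕ →₀ ℕ) := N.filter fun τ => τ m = 0

/-- The quotients by `x_m` of the members of `N` that are divisible by `x_m`. -/
noncomputable def quotPart (m : ℕ) (N : Finset (ℕ →₀ ℕ)) : Finset (ℕ →₀ ℕ) :=
  (N.filter fun τ => ¬ τ m = 0).image fun τ => τ - single m 1

/-- The union of `A` and `x_m · B`. -/
noncomputable def join (m : ℕ) (A B : Finset (ℕ →₀ ℕ)) : Finset (ℕ →₀ ℕ) :=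
  A ∪ B.image fun τ => τ + single m 1

section join

variable {m : ℕ} {N A B : Finset (ℕ →₀ ℕ)} {τ : ℕ →₀ ℕ}

theorem sub_single_add (h : τ m ≠ 0) : τ - single m 1 + single m 1 = τ :=
  tsub_add_cancel_of_le (Finsupp.single_le_iff.2 (Nat.one_le_iff_ne_zero.2 h))

theorem mem_freePart : τ ∈ freePart m N ↔ τ ∈ N ∧ τ m = 0 := Finset.mem_filter

theorem mem_quotPart : τ ∈ quotPart m N ↔ τ + single m 1 ∈ N := by
  rw [quotPart, Finset.mem_image]
  constructor
  · rintro ⟨σ, hσ, rfl⟩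
    obtain ⟨hσ, hne⟩ := Finset.mem_filter.1 hσ
    rwa [sub_single_add hne]
  · exact fun h => ⟨_, Finset.mem_filter.2 ⟨h, by simp⟩, add_tsub_cancel_right _ _⟩

theorem mem_join : τ ∈ join m A B ↔ τ ∈ A ∨ ∃ σ ∈ B, σ + single m 1 = τ := by
  simp [join]

theorem card_freePart_add_card_quotPart : (freePart m N).card + (quotPart m N).card = N.card := by
  rw [quotPart, Finset.card_image_of_injOn, freePart, Finset.card_filter_add_card_filter_not]
  intro σ hσ τ hτ h
  have h1 := (Finset.mem_filter.1 hσ).2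
  have h2 := (Finset.mem_filter.1 hτ).2
  have h3 := congrArg (· + single m 1) h
  simpa only [sub_single_add h1, sub_single_add h2] using h3

theorem join_freePart_quotPart : join m (freePart m N) (quotPart m N) = N := by
  ext τ
  rw [mem_join, mem_freePart]
  simp only [mem_quotPart]
  constructor
  · rintro (h | ⟨σ, hσ, rfl⟩)
    exacts [h.1, hσ]
  · intro h
    by_cases h0 : τ m = 0
    · exact Or.inl ⟨h, h0⟩
    · exact Or.inr ⟨_, (sub_single_add h0).symm ▸ h, sub_single_add h0⟩

theorem freePart_join (hA : ∀ τ ∈ A, τ m = 0) : freePart m (join m A B) = A := by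
  ext τ
  rw [mem_freePart, mem_join]
  constructor
  · rintro ⟨h | ⟨σ, hσ, rfl⟩, h0⟩
    · exact h
    · simp at h0
  · exact fun h => ⟨Or.inl h, hA τ h⟩

theorem quotPart_join (hA : ∀ τ ∈ A, τ m = 0) : quotPart m (join m A B) = B := by
  ext τ
  rw [mem_quotPart, mem_join]
  constructor
  · rintro (h | ⟨σ, hσ, h⟩)
    · have := hA _ h
      simp at this
    · rwa [← add_right_cancel h]
  · exact fun h => Or.inr ⟨τ, h, rfl⟩

end join

section split

variable {q n k d i j : ℕ} {N A B : Finset (ℕ →₀ ℕ)}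

theorem freePart_mem_lexIdeals (hN : N ∈ lexIdeals (q + 1) n (k + 1) d) (hi : single q i ∈ N)
    (hi' : single q (i + 1) ∉ N) :
    freePart (q + 1) N ∈ lexIdeals q n i (freePart (q + 1) N).card := by
  obtain ⟨hN, -, hn, h1, h2, h3⟩ := mem_lexIdeals.1 hN
  have hz : ∀ τ ∈ freePart (q + 1) N, ∀ k, q + 1 ≤ k → τ k = 0 := by
    intro τ hτ k hk
    obtain ⟨hτ, h0⟩ := mem_freePart.1 hτ
    rcases hk.eq_or_lt with rfl | hk
    exacts [h0, hN.apply_eq_zero h1 hτ k hk]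
  refine mem_lexIdeals.2 ⟨⟨?_, ?_⟩, rfl, ?_, ?_, ?_, ?_⟩
  · intro σ τ hle hτ
    obtain ⟨hτ, h0⟩ := mem_freePart.1 hτ
    exact mem_freePart.2 ⟨hN.lower _ _ hle hτ, Nat.le_zero.1 (h0 ▸ hle (q + 1))⟩
  · intro σ τ hd hlt hτ
    exact mem_freePart.2 ⟨hN.lex _ _ hd hlt (mem_freePart.1 hτ).1,
      apply_eq_zero_of_colex_lt hlt (hz τ hτ) _ le_rfl⟩
  · exact fun τ hτ => hn τ (mem_freePart.1 hτ).1
  · simp [mem_freePart]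
  · exact mem_freePart.2 ⟨hi, by simp⟩
  · exact fun h => hi' (mem_freePart.1 h).1

/-- A member of `N` divisible by `x_{q+1}` is higher than the power of `x_q` of the same degree;
this bounds the degrees of the quotients by `x_{q+1}`. -/
theorem quotPart_mem_lexIdeals (hN : N ∈ lexIdeals (q + 1) n (k + 1) d)
    (hi' : single q (i + 1) ∉ N) :
    quotPart (q + 1) N ∈ lexIdeals (q + 1) (i - 1) k (quotPart (q + 1) N).card := by
  obtain ⟨hN, -, hn, h1, h2, h3⟩ := mem_lexIdeals.1 hN
  refine mem_lexIdeals.2 ⟨⟨?_, ?_⟩, rfl, ?_, ?_, ?_, ?_⟩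
  · intro σ τ hle hτ
    rw [mem_quotPart] at hτ ⊢
    exact hN.lower _ _ (add_le_add_left hle _) hτ
  · intro σ τ hd hlt hτ
    rw [mem_quotPart] at hτ ⊢
    refine hN.lex _ _ (by simp [hd]) ?_ hτ
    rw [toColex_add, toColex_add]
    exact add_lt_add_left hlt _
  · intro τ hτ
    rw [mem_quotPart] at hτ
    have := hN.single_mem_of_apply_ne_zero hτ (Nat.lt_succ_self q) (by simp)
    rw [map_add, Finsupp.degree_single] at this
    have := hN.le_of_single_mem this hi'
    omega
  · rw [mem_quotPart]
    exact fun h => h1 (hN.lower _ _ le_self_add h)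
  · rwa [mem_quotPart, ← Finsupp.single_add]
  · rwa [mem_quotPart, ← Finsupp.single_add]

theorem join_mem_lexIdeals (hA : A ∈ lexIdeals q n i d) (hB : B ∈ lexIdeals (q + 1) (i - 1) k j)
    (hi : 1 ≤ i) (hin : i ≤ n) : join (q + 1) A B ∈ lexIdeals (q + 1) n (k + 1) (d + j) := by
  obtain ⟨hA, hAd, hAn, hA1, hA2, hA3⟩ := mem_lexIdeals.1 hA
  obtain ⟨hB, hBd, hBn, hB1, hB2, hB3⟩ := mem_lexIdeals.1 hB
  have hAz := fun τ hτ => hA.apply_eq_zero (τ := τ) hA1 hτ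
  -- `A` is full up to degree `i`, and the members of `x_{q+1} · B` have degree at most `i`.
  have hfull : ∀ σ : ℕ →₀ ℕ, σ.degree ≤ i → (∀ k, q + 2 ≤ k → σ k = 0) → σ (q + 1) = 0 →
      σ ∈ A := by
    intro σ hσ h1 h2
    refine hA.mem_of_single_mem hA2 hσ fun k hk => ?_
    rcases Nat.eq_or_lt_of_le (Nat.succ_le_of_lt hk) with rfl | h
    exacts [h2, h1 k h]
  have hBe : ∀ τ ∈ B, (τ + single (q + 1) 1).degree ≤ i ∧
      ∀ k, q + 2 ≤ k → (τ + single (q + 1) 1 : ℕ →₀ ℕ) k = 0 := by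
    intro τ hτ
    constructor
    · have := hBn τ hτ
      rw [map_add, Finsupp.degree_single]; omega
    · intro k hk
      have h1 : q + 1 ≠ k := by omega
      simp [hB.apply_eq_zero hB1 hτ k hk, h1.symm]
  refine mem_lexIdeals.2 ⟨⟨?_, ?_⟩, ?_, ?_, ?_, ?_, ?_⟩
  · intro σ τ hle hτ
    rw [mem_join] at hτ ⊢
    rcases hτ with hτ | ⟨ρ, hρ, rfl⟩
    · exact Or.inl (hA.lower _ _ hle hτ)
    · obtain ⟨h1, h2⟩ := hBe ρ hρ
      by_cases h0 : σ (q + 1) = 0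
      · exact Or.inl (hfull σ ((Finsupp.degree_mono hle).trans h1)
          (fun k hk => Nat.le_zero.1 (h2 k hk ▸ hle k)) h0)
      · refine Or.inr ⟨σ - single (q + 1) 1, hB.lower _ ρ ?_ hρ, sub_single_add h0⟩
        exact tsub_le_iff_right.2 hle
  · intro σ τ hd hlt hτ
    rw [mem_join] at hτ ⊢
    rcases hτ with hτ | ⟨ρ, hρ, rfl⟩
    · exact Or.inl (hA.lex _ _ hd hlt hτ)
    · obtain ⟨h1, h2⟩ := hBe ρ hρ
      by_cases h0 : σ (q + 1) = 0
      · exact Or.inl (hfull σ (hd.trans_le h1) (apply_eq_zero_of_colex_lt hlt h2) h0)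
      · have hσ := sub_single_add h0
        refine Or.inr ⟨σ - single (q + 1) 1, hB.lex _ ρ ?_ ?_ hρ, hσ⟩
        · rw [← hσ, map_add, map_add] at hd
          exact add_right_cancel hd
        · rw [← hσ, toColex_add, toColex_add] at hlt
          exact lt_of_add_lt_add_right hlt
  · rw [← card_freePart_add_card_quotPart (m := q + 1),
      freePart_join fun τ hτ => hAz τ hτ _ le_rfl, quotPart_join fun τ hτ => hAz τ hτ _ le_rfl,
      hAd, hBd]
  · intro τ hτ
    rcases mem_join.1 hτ with hτ | ⟨ρ, hρ, rfl⟩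
    exacts [hAn τ hτ, (hBe ρ hρ).1.trans hin]
  · rw [mem_join]
    rintro (h | ⟨ρ, hρ, h⟩)
    · have := hAz _ h (q + 1 + 1) (Nat.le_succ _)
      simp at this
    · have := DFunLike.congr_fun h (q + 1)
      simp at this
  · exact mem_join.2 (Or.inr ⟨_, hB2, (Finsupp.single_add _ _ _).symm⟩)
  · rw [mem_join]
    rintro (h | ⟨ρ, hρ, h⟩)
    · have := hAz _ h (q + 1) le_rfl
      simp at this
    · rw [Finsupp.single_add] at h
      exact hB3 (add_right_cancel h ▸ hρ)

end split

/-- The recursion comes from the bijection `N ↦ (freePart N, quotPart N)`: here `j` is the number of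
members of the second part and `i` is the degree up to which the first part is full. -/
theorem card_lexIdeals_succ_succ (q n k d : ℕ) :
    (lexIdeals (q + 1) n (k + 1) d).card =
      ∑ j ∈ Finset.Icc 1 (d - 1), ∑ i ∈ Finset.Icc (k + 1) n,
        (lexIdeals q n i (d - j)).card * (lexIdeals (q + 1) (i - 1) k j).card := by
  classical
  rw [← Finset.sum_product']
  simp_rw [← Finset.card_product]
  rw [← Finset.card_biUnion]
  · refine Finset.card_bij' (fun N _ => (freePart (q + 1) N, quotPart (q + 1) N))
      (fun P _ => join (q + 1) P.1 P.2) ?_ ?_ ?_ ?_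
    · intro N hN
      obtain ⟨hN', hd, hn, h1, h2, h3⟩ := mem_lexIdeals.1 hN
      have h0 := hN'.zero_mem h2
      obtain ⟨i, hi, hi'⟩ := hN'.exists_top h0 q
      have hA := freePart_mem_lexIdeals hN hi hi'
      have hB := quotPart_mem_lexIdeals hN hi'
      have hc := card_freePart_add_card_quotPart (m := q + 1) (N := N)
      have hA0 : 0 < (freePart (q + 1) N).card := Finset.card_pos.2 ⟨0, mem_freePart.2 ⟨h0, rfl⟩⟩
      have hB0 : 0 < (quotPart (q + 1) N).card :=
        Finset.card_pos.2 ⟨_, (mem_lexIdeals.1 hB).2.2.2.2.1⟩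
      have hki := hN'.le_of_single_mem (hN'.single_mem_of_var_le (Nat.le_succ q) h2) hi'
      have hin := hn _ hi
      rw [Finsupp.degree_single] at hin
      refine Finset.mem_biUnion.2 ⟨((quotPart (q + 1) N).card, i), ?_, ?_⟩
      · simp only [Finset.mem_product, Finset.mem_Icc]; omega
      · refine Finset.mem_product.2 ⟨?_, hB⟩
        convert hA using 2
        dsimp only; omega
    · rintro ⟨A, B⟩ hP
      obtain ⟨⟨j, i⟩, hji, hP⟩ := Finset.mem_biUnion.1 hP
      simp only [Finset.mem_product, Finset.mem_Icc] at hP hji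
      have := join_mem_lexIdeals hP.1 hP.2 (by omega) hji.2.2
      rwa [Nat.sub_add_cancel (by omega)] at this
    · exact fun N _ => join_freePart_quotPart
    · rintro ⟨A, B⟩ hP
      obtain ⟨⟨j, i⟩, hji, hP⟩ := Finset.mem_biUnion.1 hP
      obtain ⟨hA, -, -, hA1, -⟩ := mem_lexIdeals.1 (Finset.mem_product.1 hP).1
      have hz := fun τ hτ => hA.apply_eq_zero (τ := τ) hA1 hτ _ le_rfl
      exact Prod.ext (freePart_join hz) (quotPart_join hz)
  · rintro ⟨j, i⟩ _ ⟨j', i'⟩ _ hne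
    refine Finset.disjoint_left.2 fun P hP hP' => hne ?_
    obtain ⟨hA, hB⟩ := Finset.mem_product.1 hP
    obtain ⟨hA', hB'⟩ := Finset.mem_product.1 hP'
    obtain ⟨hA, -, -, -, h2, h3⟩ := mem_lexIdeals.1 hA
    obtain ⟨-, -, -, -, h2', h3'⟩ := mem_lexIdeals.1 hA'
    have hj := (mem_lexIdeals.1 hB).2.1
    have hj' := (mem_lexIdeals.1 hB').2.1
    exact Prod.ext (hj.symm.trans hj')
      (le_antisymm (hA.le_of_single_mem h2 h3') (hA.le_of_single_mem h2' h3))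

theorem card_lexIdeals_eq_iter (q n k d : ℕ) :
    (lexIdeals q n k d).card = OSeq.iter (q + 1) n k d := by
  induction q generalizing n k d with
  | zero => rw [card_lexIdeals_zero, OSeq.iter]
  | succ q ihq =>
    induction k generalizing n d with
    | zero => rw [card_lexIdeals_succ_zero, OSeq.iter]; simp_rw [ihq]
    | succ k ihk => rw [card_lexIdeals_succ_succ, OSeq.iter]; simp_rw [ihq, ihk]

/-! ### Lex-segment order ideals and their Hilbert functions -/

/-- With as many variables as members, the conditions on the number of variables, on the degrees and
on the degree up to which the ideal is full are automatic. -/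
theorem mem_lexIdeals_self {q : ℕ} {N : Finset (ℕ →₀ ℕ)} :
    N ∈ lexIdeals q q 0 (q + 1) ↔ IsLexOrderIdeal N ∧ N.card = q + 1 := by
  rw [mem_lexIdeals]
  constructor
  · exact fun h => ⟨h.1, h.2.1⟩
  · rintro ⟨hN, hc⟩
    have h1 : single q 1 ∉ N := fun h => by
      have := hN.lt_card_of_single_one_mem h
      omega
    refine ⟨hN, hc, fun τ hτ => ?_, fun h => h1 (hN.single_mem_of_var_le (Nat.le_succ q) h),
      ?_, h1⟩
    · have := hN.lt_card_of_single_mem (hN.single_zero_degree_mem hτ)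
      omega
    · obtain ⟨τ, hτ⟩ := Finset.card_pos.1 (by omega : 0 < N.card)
      simpa using hN.zero_mem hτ

/-- The Hilbert function of the order ideal `N`: the number of members of degree `t`. -/
noncomputable def count (N : Finset (ℕ →₀ ℕ)) (t : ℕ) : ℕ := (N.filter fun τ => τ.degree = t).card

theorem exists_range_supports (N : Finset (ℕ →₀ ℕ)) :
    ∃ q, ∀ τ ∈ N, τ.support ⊆ Finset.range q := by
  obtain ⟨q, hq⟩ := (N.biUnion Finsupp.support).exists_nat_subset_range
  exact ⟨q, fun τ hτ => (Finset.subset_biUnion_of_mem _ hτ).trans hq⟩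

theorem IsLexOrderIdeal.isInitial {N : Finset (ℕ →₀ ℕ)} (hN : IsLexOrderIdeal N) {S : Finset ℕ}
    (hS : ∀ τ ∈ N, τ.support ⊆ S) (t : ℕ) :
    IsInitial (terms S t) (N.filter fun τ => τ.degree = t) := by
  constructor
  · intro τ hτ
    obtain ⟨hτ, ht⟩ := Finset.mem_filter.1 hτ
    exact mem_terms.2 ⟨hS τ hτ, ht⟩
  · intro τ hτ σ hσ hlt
    obtain ⟨hτ, ht⟩ := Finset.mem_filter.1 hτ
    have hσ := (mem_terms.1 hσ).2
    exact Finset.mem_filter.2 ⟨hN.lex σ τ (hσ.trans ht.symm) hlt hτ, hσ⟩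

/-- A lex-segment order ideal is determined by its Hilbert function. -/
theorem IsLexOrderIdeal.eq_of_count_eq {N N' : Finset (ℕ →₀ ℕ)} (hN : IsLexOrderIdeal N)
    (hN' : IsLexOrderIdeal N') (h : count N = count N') : N = N' := by
  have key : ∀ {N N' : Finset (ℕ →₀ ℕ)}, IsLexOrderIdeal N → IsLexOrderIdeal N' →
      count N = count N' → N ⊆ N' := by
    intro N N' hN hN' h τ hτ
    obtain ⟨q, hq⟩ := exists_range_supports (N ∪ N')
    have := (hN.isInitial (fun σ hσ => hq σ (Finset.mem_union_left _ hσ))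
      τ.degree).subset_of_card_le
      (hN'.isInitial (fun σ hσ => hq σ (Finset.mem_union_right _ hσ)) τ.degree)
      (congrFun h _).le
    exact (Finset.mem_filter.1 (this (Finset.mem_filter.2 ⟨hτ, rfl⟩))).1
  exact (key hN hN' h).antisymm (key hN' hN h.symm)

theorem IsInitial.shadow {S : Finset ℕ} {t : ℕ} {L : Finset (ℕ →₀ ℕ)}
    (hL : IsInitial (terms S (t + 1)) L) : IsInitial (terms S t) (shadow S t L) := by
  refine ⟨fun σ hσ => (mem_shadow.1 hσ).1, fun τ hτ σ hσ hlt => ?_⟩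
  obtain ⟨-, j, hj⟩ := mem_shadow.1 hτ
  refine mem_shadow.2 ⟨hσ, j, hL.2 _ hj _ ?_ ?_⟩
  · have hjS : j ∈ S := (mem_terms.1 (hL.1 hj)).1 (by simp)
    obtain ⟨h1, h2⟩ := mem_terms.1 hσ
    refine mem_terms.2 ⟨Finsupp.support_add.trans (Finset.union_subset h1 ?_), by simp [h2]⟩
    exact Finsupp.support_single_subset.trans (Finset.singleton_subset_iff.2 hjS)
  · rw [toColex_add, toColex_add]
    exact add_lt_add_left hlt _

/-- **Macaulay's theorem** on Hilbert functions: every finite order ideal of terms has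
the Hilbert function of a lex-segment order ideal. -/
theorem exists_isLexOrderIdeal_count_eq {N : Finset (ℕ →₀ ℕ)}
    (hN : ∀ σ τ, σ ≤ τ → τ ∈ N → σ ∈ N) : ∃ L, IsLexOrderIdeal L ∧ count L = count N := by
  obtain ⟨q, hq⟩ := exists_range_supports N
  have hsub : ∀ t, (N.filter fun τ => τ.degree = t) ⊆ terms (Finset.range q) t := by
    intro t τ hτ
    obtain ⟨hτ, ht⟩ := Finset.mem_filter.1 hτ
    exact mem_terms.2 ⟨hq τ hτ, ht⟩
  choose L hL hLc using fun t => exists_isInitial_card _ (Finset.card_le_card (hsub t))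
  have hmem : ∀ {τ}, τ ∈ (N.image Finsupp.degree).biUnion L ↔ τ ∈ L τ.degree := by
    intro τ
    rw [Finset.mem_biUnion]
    constructor
    · rintro ⟨t, -, hτ⟩
      rwa [(mem_terms.1 ((hL t).1 hτ)).2]
    · intro hτ
      have : 0 < (N.filter fun σ => σ.degree = τ.degree).card := by
        rw [← hLc]; exact Finset.card_pos.2 ⟨τ, hτ⟩
      obtain ⟨σ, hσ⟩ := Finset.card_pos.1 this
      obtain ⟨hσ, hd⟩ := Finset.mem_filter.1 hσ
      exact ⟨τ.degree, Finset.mem_image.2 ⟨σ, hσ, hd⟩, hτ⟩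
  -- The shadow of `L (t + 1)` and `L t` are both initial, so comparing their sizes is enough.
  have hstep : ∀ t, shadow (Finset.range q) t (L (t + 1)) ⊆ L t := by
    intro t
    refine (hL (t + 1)).shadow.subset_of_card_le (hL t) ?_
    refine (shadowBound _ t _ _ (hsub (t + 1)) (hL (t + 1)) (hLc (t + 1)).le).trans ?_
    rw [hLc]
    refine Finset.card_le_card fun σ hσ => ?_
    obtain ⟨hσ, j, hj⟩ := mem_shadow.1 hσ
    exact Finset.mem_filter.2 ⟨hN _ _ le_self_add (Finset.mem_filter.1 hj).1, (mem_terms.1 hσ).2⟩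
  refine ⟨(N.image Finsupp.degree).biUnion L, ⟨?_, ?_⟩, ?_⟩
  · intro σ τ hle
    obtain ⟨ρ, rfl⟩ := exists_add_of_le hle
    clear hle
    induction ρ using Finsupp.induction_linear generalizing σ with
    | zero => simp
    | add f g hf hg => exact fun h => hf σ (hg (σ + f) (by rwa [add_assoc]))
    | single j b =>
      induction b with
      | zero => simp
      | succ b ih =>
        intro h
        refine ih (hmem.2 (hstep _ (mem_shadow.2 ⟨mem_terms.2 ⟨?_, rfl⟩, j, ?_⟩)))
        · refine subset_trans ?_ (mem_terms.1 ((hL _).1 (hmem.1 h))).1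
          exact Finsupp.support_mono (add_le_add_right (Finsupp.single_mono (Nat.le_succ b)) σ)
        · rw [hmem, Finsupp.single_add, ← add_assoc, map_add, Finsupp.degree_single] at h
          exact h
  · intro σ τ hd hlt hτ
    rw [hmem] at hτ ⊢
    rw [hd]
    refine (hL _).2 τ hτ σ (mem_terms.2 ⟨fun k hk => ?_, hd⟩) hlt
    by_contra hkq
    refine Finsupp.mem_support_iff.1 hk (apply_eq_zero_of_colex_lt (m := q) hlt ?_ k
      (by simpa using hkq))
    intro l hl
    by_contra hne
    have := (mem_terms.1 ((hL _).1 hτ)).1 (Finsupp.mem_support_iff.2 hne)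
    rw [Finset.mem_range] at this
    omega
  · ext t
    rw [count, count, ← hLc]
    congr 1
    ext τ
    rw [Finset.mem_filter, hmem]
    constructor
    · rintro ⟨h, rfl⟩; exact h
    · intro h
      have := (mem_terms.1 ((hL t).1 h)).2
      exact ⟨this.symm ▸ h, this⟩

open MvPolynomial

/-! ### Hilbert functions and leading terms -/

section leading

variable {K : Type*} [Field K] {p : ℕ}

/-- The exponents that are not leading exponents, for Mathlib's lexicographic monomial order, of
homogeneous members of `I`. Any monomial order would do here. -/
def standardTerms (I : Ideal (MvPolynomial (Fin p) K)) : Set (Fin p →₀ ℕ) :=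
  {α | ∀ f ∈ I, f.IsHomogeneous α.degree → f ≠ 0 →
    (MonomialOrder.lex (σ := Fin p)).degree f ≠ α}

/-- A space of polynomials has as its dimension the number of its leading exponents. -/
theorem finrank_eq_card_degree {σ : Type*} (m : MonomialOrder σ)
    (W : Submodule K (MvPolynomial σ K)) (F : Finset (σ →₀ ℕ))
    (hF : ∀ α, α ∈ F ↔ ∃ f ∈ W, f ≠ 0 ∧ m.degree f = α) :
    Module.finrank K W = F.card := by
  classical
  let φ : W →ₗ[K] (F → K) := LinearMap.pi fun α => (lcoeff K α.1).comp W.subtype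
  have hφ : Function.Injective φ := by
    rw [← LinearMap.ker_eq_bot, LinearMap.ker_eq_bot']
    rintro ⟨f, hf⟩ h0
    by_contra hne
    have hne : f ≠ 0 := fun h => hne (Subtype.ext h)
    have := congrFun h0 ⟨m.degree f, (hF _).2 ⟨f, hf, hne, rfl⟩⟩
    exact m.coeff_degree_ne_zero_iff.2 hne this
  have := FiniteDimensional.of_injective φ hφ
  refine le_antisymm ?_ ?_
  · simpa using LinearMap.finrank_le_finrank_of_injective hφ
  · choose f hfW hf0 hfd using fun α : F => (hF α.1).1 α.2
    have hli : LinearIndependent K fun α : F => (⟨f α, hfW α⟩ : W) := by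
      rw [Fintype.linearIndependent_iff]
      intro g hg
      by_contra! hne
      obtain ⟨α, hα, hmax⟩ := Finset.exists_max_image
        (Finset.univ.filter fun α : F => g α ≠ 0) (fun α => m.toSyn α.1)
        (by obtain ⟨α, hα⟩ := hne; exact ⟨α, by simpa using hα⟩)
      have hα : g α ≠ 0 := by simpa using hα
      have h := congrArg (fun w : W => coeff α.1 w.1) hg
      simp only [Submodule.coe_sum, Submodule.coe_smul, coeff_sum, coeff_smul,
        Submodule.coe_zero, coeff_zero] at h
      rw [Finset.sum_eq_single α] at h
      · have := m.coeff_degree_ne_zero_iff.2 (hf0 α)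
        rw [hfd] at this
        exact (mul_ne_zero hα this) h
      · intro β _ hβ
        by_cases hg0 : g β = 0
        · simp [hg0]
        · have hle := hmax β (by simpa using hg0)
          have hlt : m.toSyn β.1 < m.toSyn α.1 :=
            lt_of_le_of_ne hle fun h => hβ (Subtype.ext (m.toSyn.injective h))
          rw [m.coeff_eq_zero_of_lt (by rwa [hfd]), smul_zero]
      · simp
    simpa using hli.fintype_card_le_finrank

theorem mem_terms_univ {t : ℕ} {α : Fin p →₀ ℕ} : α ∈ terms Finset.univ t ↔ α.degree = t := by
  simp [mem_terms]

theorem degree_lex_degree {f : MvPolynomial (Fin p) K} {t : ℕ} (hf : f.IsHomogeneous t)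
    (h0 : f ≠ 0) : ((MonomialOrder.lex (σ := Fin p)).degree f).degree = t := by
  by_contra h
  exact (MonomialOrder.lex.coeff_degree_ne_zero_iff.2 h0) (hf.coeff_eq_zero h)

open Classical in
/-- The Hilbert function counts the exponents that are not leading exponents. -/
theorem hilbertFn_eq_card (I : Ideal (MvPolynomial (Fin p) K)) (t : ℕ) :
    hilbertFn I t = ((terms Finset.univ t).filter (· ∈ standardTerms I)).card := by
  have h1 : Module.finrank K (homogeneousSubmodule (Fin p) K t) =
      (terms (Finset.univ : Finset (Fin p)) t).card := by
    refine finrank_eq_card_degree MonomialOrder.lex _ _ fun α => ?_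
    rw [mem_terms_univ]
    constructor
    · intro hα
      exact ⟨monomial α 1, isHomogeneous_monomial _ hα, by simp,
        by rw [MonomialOrder.degree_monomial, if_neg one_ne_zero]⟩
    · rintro ⟨f, hf, h0, rfl⟩
      exact degree_lex_degree hf h0
  have h2 : Module.finrank K (homogeneousSubmodule (Fin p) K t ⊓ I.restrictScalars K :
        Submodule K (MvPolynomial (Fin p) K)) =
      ((terms (Finset.univ : Finset (Fin p)) t).filter (· ∉ standardTerms I)).card := by
    refine finrank_eq_card_degree MonomialOrder.lex _ _ fun α => ?_
    rw [Finset.mem_filter, mem_terms_univ]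
    constructor
    · rintro ⟨rfl, hα⟩
      simp only [standardTerms, Set.mem_ofPred_eq, not_forall, not_not] at hα
      obtain ⟨f, hfI, hf, h0, hd⟩ := hα
      exact ⟨f, ⟨hf, hfI⟩, h0, hd⟩
    · rintro ⟨f, ⟨hf, hfI⟩, h0, rfl⟩
      have hd := degree_lex_degree hf h0
      exact ⟨hd, fun h => h f hfI (hd.symm ▸ hf) h0 rfl⟩
  rw [hilbertFn, h1, h2, ← Finset.card_filter_add_card_filter_not (s := terms Finset.univ t)
    (· ∈ standardTerms I), Nat.add_sub_cancel]

theorem isLowerSet_standardTerms (I : Ideal (MvPolynomial (Fin p) K)) :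
    IsLowerSet (standardTerms I) := by
  classical
  intro β α hle hβ f hf hfh h0 hd
  obtain ⟨γ, rfl⟩ := exists_add_of_le hle
  have hγ : (monomial γ (1 : K)) ≠ 0 := by simp
  refine hβ (f * monomial γ 1) (I.mul_mem_right _ hf) ?_ (mul_ne_zero h0 hγ) ?_
  · rw [map_add]
    exact hfh.mul (isHomogeneous_monomial _ rfl)
  · rw [MonomialOrder.degree_mul h0 hγ, hd, MonomialOrder.degree_monomial, if_neg one_ne_zero]

theorem standardTerms_eq_sousEscalier {J : Ideal (MvPolynomial (Fin p) K)}
    (hJ : IsMonomialIdeal J) : standardTerms J = sousEscalier J := by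
  classical
  obtain ⟨S, rfl⟩ := hJ
  ext α
  constructor
  · intro hα hmem
    exact hα _ hmem (isHomogeneous_monomial _ rfl) (by simp)
      (by rw [MonomialOrder.degree_monomial, if_neg one_ne_zero])
  · intro hα f hf _ h0 hd
    refine hα (mem_ideal_span_monomial_image.2 fun β hβ => ?_)
    obtain rfl : β = α := by
      have := support_monomial_subset hβ
      simpa using this
    exact mem_ideal_span_monomial_image.1 hf β
      (hd ▸ MonomialOrder.lex.degree_mem_support h0)

/-- The monomial ideal whose terms are those outside `N`. -/
noncomputable def idealOf (K : Type*) [Field K] (N : Set (Fin p →₀ ℕ)) :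
    Ideal (MvPolynomial (Fin p) K) :=
  Ideal.span ((fun α => monomial α (1 : K)) '' Nᶜ)

theorem isMonomialIdeal_idealOf (N : Set (Fin p →₀ ℕ)) : IsMonomialIdeal (idealOf K N) :=
  ⟨_, rfl⟩

theorem sousEscalier_idealOf {N : Set (Fin p →₀ ℕ)} (hN : IsLowerSet N) :
    sousEscalier (idealOf K N) = N := by
  classical
  ext α
  rw [sousEscalier, Set.mem_ofPred_eq, idealOf, mem_ideal_span_monomial_image, support_monomial,
    if_neg one_ne_zero]
  constructor
  · intro h
    by_contra hα
    exact h fun β hβ => ⟨α, hα, (Finset.mem_singleton.1 hβ).ge⟩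
  · intro hα h
    obtain ⟨β, hβ, hle⟩ := h α (Finset.mem_singleton_self _)
    exact hβ (hN hle hα)

theorem isArtinianRing_idealOf {N : Set (Fin p →₀ ℕ)} (hN : N.Finite) :
    IsArtinianRing (MvPolynomial (Fin p) K ⧸ idealOf K N) := by
  -- The quotient is spanned by the terms in `N`, hence finite-dimensional.
  have : Module.Finite K (MvPolynomial (Fin p) K ⧸ idealOf K N) := by
    let π := (Ideal.Quotient.mkₐ K (idealOf K N)).toLinearMap
    refine ⟨Submodule.fg_def.2 ⟨(fun α => π (monomial α 1)) '' N, hN.image _, ?_⟩⟩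
    rw [eq_top_iff]
    rintro x -
    obtain ⟨f, rfl⟩ := Ideal.Quotient.mk_surjective x
    change π f ∈ _
    rw [f.as_sum, map_sum]
    refine Submodule.sum_mem _ fun α _ => ?_
    rw [← mul_one (coeff α f), ← smul_eq_mul, ← smul_monomial, map_smul]
    refine Submodule.smul_mem _ _ ?_
    by_cases hα : α ∈ N
    · exact Submodule.subset_span ⟨α, hα, rfl⟩
    · have : π (monomial α 1) = 0 :=
        Ideal.Quotient.eq_zero_iff_mem.2 (Ideal.subset_span ⟨α, hα, rfl⟩)
      rw [this]
      exact Submodule.zero_mem _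
  exact IsArtinianRing.of_finite K _

end leading

section homogeneous

attribute [local instance] MvPolynomial.gradedAlgebra

theorem isHomogeneous_idealOf {K : Type*} [Field K] {p : ℕ} (N : Set (Fin p →₀ ℕ)) :
    (idealOf K N).IsHomogeneous (homogeneousSubmodule (Fin p) K) := by
  refine Ideal.homogeneous_span _ _ ?_
  rintro _ ⟨α, -, rfl⟩
  exact ⟨α.degree, isHomogeneous_monomial _ rfl⟩

end homogeneous

/-! ### Terms in finitely many of the variables -/

section extend

variable {p : ℕ} {α β : Fin p →₀ ℕ} {τ : ℕ →₀ ℕ}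

/-- A term in `p` variables as a term in the variables `x_0, x_1, …`. -/
noncomputable def extend (α : Fin p →₀ ℕ) : ℕ →₀ ℕ := α.embDomain Fin.valEmbedding

theorem extend_injective : Function.Injective (extend (p := p)) := Finsupp.embDomain_injective _

theorem extend_apply_val (α : Fin p →₀ ℕ) (i : Fin p) : extend α i = α i :=
  Finsupp.embDomain_apply_self Fin.valEmbedding α i

theorem extend_apply_of_le (α : Fin p →₀ ℕ) {k : ℕ} (hk : p ≤ k) : extend α k = 0 := by
  refine Finsupp.embDomain_of_notMem_range _ _ _ ?_
  rintro ⟨i, rfl⟩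
  exact absurd i.2 (not_lt.2 hk)

theorem degree_extend (α : Fin p →₀ ℕ) : (extend α).degree = α.degree := by
  rw [extend, Finsupp.embDomain_eq_mapDomain, Finsupp.degree_mapDomain]

theorem exists_extend_eq (h : ∀ k, p ≤ k → τ k = 0) : ∃ α : Fin p →₀ ℕ, extend α = τ := by
  refine ⟨Finsupp.equivFunOnFinite.symm fun i => τ i, ?_⟩
  ext k
  by_cases hk : k < p
  · exact extend_apply_val _ ⟨k, hk⟩
  · rw [extend_apply_of_le _ (not_lt.1 hk), h k (not_lt.1 hk)]

theorem extend_le_extend_iff : extend α ≤ extend β ↔ α ≤ β := by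
  constructor
  · intro h i
    simpa only [extend_apply_val] using h i
  · intro h k
    by_cases hk : k < p
    · exact (extend_apply_val α ⟨k, hk⟩).le.trans ((h _).trans (extend_apply_val β ⟨k, hk⟩).ge)
    · simp [extend_apply_of_le _ (not_lt.1 hk)]

theorem extend_colex_lt_iff : toColex (extend α) < toColex (extend β) ↔ LexLT α β := by
  rw [Finsupp.Colex.lt_iff, LexLT, Finsupp.lex_def]
  simp only [ofColex_toColex]
  constructor
  · rintro ⟨k, h1, h2⟩
    have hk : k < p := by
      by_contra hk
      rw [extend_apply_of_le β (not_lt.1 hk)] at h2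
      omega
    refine ⟨⟨k, hk⟩, fun l hl => ?_, ?_⟩
    · simpa only [extend_apply_val] using h1 l hl
    · rwa [← extend_apply_val α, ← extend_apply_val β]
  · rintro ⟨k, h1, h2⟩
    refine ⟨k, fun l hl => ?_, by rwa [extend_apply_val, extend_apply_val]⟩
    by_cases hlp : l < p
    · have := h1 ⟨l, hlp⟩ hl
      rwa [← extend_apply_val α, ← extend_apply_val β] at this
    · simp [extend_apply_of_le _ (not_lt.1 hlp)]

theorem extend_single (i : Fin p) (b : ℕ) :
    extend (Finsupp.single i b) = Finsupp.single (i : ℕ) b :=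
  Finsupp.embDomain_single _ _ _

variable {M : Set (Fin p →₀ ℕ)} {N : Finset (ℕ →₀ ℕ)}

/-- `N` consists of the terms in `M`, regarded as terms in the variables `x_0, x_1, …`. -/
def IsExtension (M : Set (Fin p →₀ ℕ)) (N : Finset (ℕ →₀ ℕ)) : Prop :=
  (N : Set (ℕ →₀ ℕ)) = extend '' M

theorem IsExtension.mem_iff (h : IsExtension M N) : τ ∈ N ↔ ∃ α ∈ M, extend α = τ := by
  rw [← Finset.mem_coe, h]; rfl

theorem IsExtension.extend_mem_iff (h : IsExtension M N) : extend α ∈ N ↔ α ∈ M := by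
  rw [← Finset.mem_coe, h, extend_injective.mem_set_image]

theorem IsExtension.preimage_eq (h : IsExtension M N) : extend ⁻¹' (N : Set (ℕ →₀ ℕ)) = M := by
  ext α
  exact h.extend_mem_iff

theorem exists_isExtension (hM : M.Finite) : ∃ N, IsExtension M N :=
  ⟨(hM.image extend).toFinset, by simp [IsExtension]⟩

theorem isExtension_preimage (h : ∀ τ ∈ N, ∀ k, p ≤ k → τ k = 0) :
    IsExtension (extend (p := p) ⁻¹' (N : Set (ℕ →₀ ℕ))) N := by
  ext τ
  constructor
  · intro hτ
    obtain ⟨α, rfl⟩ := exists_extend_eq (h τ hτ)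
    exact ⟨α, hτ, rfl⟩
  · rintro ⟨α, hα, rfl⟩
    exact hα

theorem IsExtension.lower (h : IsExtension M N) (hM : IsLowerSet M) :
    ∀ σ τ, σ ≤ τ → τ ∈ N → σ ∈ N := by
  intro σ τ hle hτ
  obtain ⟨β, hβ, rfl⟩ := h.mem_iff.1 hτ
  obtain ⟨α, rfl⟩ := exists_extend_eq (p := p) (τ := σ)
    fun k hk => Nat.le_zero.1 (extend_apply_of_le β hk ▸ hle k)
  exact h.extend_mem_iff.2 (hM (extend_le_extend_iff.1 hle) hβ)

theorem IsExtension.isLowerSet (h : IsExtension M N) (hN : IsLexOrderIdeal N) : IsLowerSet M :=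
  fun _ _ hle hβ => h.extend_mem_iff.1
    (hN.lower _ _ (extend_le_extend_iff.2 hle) (h.extend_mem_iff.2 hβ))

theorem IsExtension.isLexOrderIdeal (h : IsExtension M N) (hM : IsLowerSet M)
    (hlex : ∀ β ∈ M, ∀ α : Fin p →₀ ℕ, α.degree = β.degree → LexLT α β → α ∈ M) :
    IsLexOrderIdeal N := by
  refine ⟨h.lower hM, fun σ τ hd hlt hτ => ?_⟩
  obtain ⟨β, hβ, rfl⟩ := h.mem_iff.1 hτ
  obtain ⟨α, rfl⟩ := exists_extend_eq
    (apply_eq_zero_of_colex_lt hlt fun k hk => extend_apply_of_le β hk)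
  rw [degree_extend, degree_extend] at hd
  exact h.extend_mem_iff.2 (hlex β hβ α hd (extend_colex_lt_iff.1 hlt))

open Classical in
theorem IsExtension.count_eq (h : IsExtension M N) (t : ℕ) :
    count N t = ((terms Finset.univ t).filter (· ∈ M)).card := by
  rw [count, ← Finset.card_image_of_injective _ extend_injective]
  congr 1
  ext τ
  simp only [Finset.mem_filter, Finset.mem_image, mem_terms_univ, h.mem_iff]
  constructor
  · rintro ⟨⟨α, hα, rfl⟩, hd⟩
    exact ⟨α, ⟨by rwa [degree_extend] at hd, hα⟩, rfl⟩
  · rintro ⟨α, ⟨hd, hα⟩, rfl⟩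
    exact ⟨⟨α, hα, rfl⟩, by rwa [degree_extend]⟩

theorem IsExtension.hilbertFn_eq {K : Type*} [Field K] {I : Ideal (MvPolynomial (Fin p) K)}
    (h : IsExtension (standardTerms I) N) : hilbertFn I = count N := by
  classical
  ext t
  rw [hilbertFn_eq_card, h.count_eq]

theorem IsExtension.hilbertFn_idealOf {K : Type*} [Field K] (h : IsExtension M N)
    (hM : IsLowerSet M) : hilbertFn (idealOf K M) = count N := by
  have hst := standardTerms_eq_sousEscalier (isMonomialIdeal_idealOf (K := K) M)
  rw [sousEscalier_idealOf hM] at hst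
  exact IsExtension.hilbertFn_eq (by rwa [hst])

end extend

theorem count_ne_zero_iff {N : Finset (ℕ →₀ ℕ)} {t : ℕ} :
    count N t ≠ 0 ↔ ∃ τ ∈ N, τ.degree = t := by
  rw [count, ← Nat.pos_iff_ne_zero, Finset.card_pos]
  exact ⟨fun ⟨τ, h⟩ => ⟨τ, Finset.mem_filter.1 h⟩, fun ⟨τ, h⟩ => ⟨τ, Finset.mem_filter.2 h⟩⟩

theorem multiplicity_count (N : Finset (ℕ →₀ ℕ)) : multiplicity (count N) = N.card := by
  rw [multiplicity, finsum_eq_sum_of_support_subset (s := N.image Finsupp.degree),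
    Finset.card_eq_sum_card_image Finsupp.degree]
  · rfl
  · intro t ht
    obtain ⟨τ, hτ, rfl⟩ := count_ne_zero_iff.1 (Function.mem_support.1 ht)
    exact Finset.mem_coe.2 (Finset.mem_image_of_mem _ hτ)

/-- A positive multiplicity forces the Hilbert function to have finite support, as `finsum` takes
the value `0` otherwise. -/
theorem finite_standardTerms {K : Type*} [Field K] {p : ℕ} {I : Ideal (MvPolynomial (Fin p) K)}
    (h : 1 ≤ multiplicity (hilbertFn I)) : (standardTerms I).Finite := by
  classical
  have hfin : (Function.support (hilbertFn I)).Finite := by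
    by_contra hinf
    rw [multiplicity, finsum_of_infinite_support hinf] at h
    omega
  refine (hfin.biUnion fun t _ => (terms (Finset.univ : Finset (Fin p)) t).finite_toSet).subset ?_
  intro α hα
  refine Set.mem_biUnion (x := α.degree) ?_ (Finset.mem_coe.2 (mem_terms_univ.2 rfl))
  rw [Function.mem_support, hilbertFn_eq_card, ← Nat.pos_iff_ne_zero, Finset.card_pos]
  exact ⟨α, Finset.mem_filter.2 ⟨mem_terms_univ.2 rfl, hα⟩⟩

/-! ### Lex-segment ideals and `O`-sequences -/

section translate

variable {K : Type*} [Field K] {q n k d : ℕ} {N : Finset (ℕ →₀ ℕ)}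

/-- The Hilbert function is maximal in degree `t` exactly when the highest term of degree `t`, the
power of the last variable, is present. -/
theorem IsLexOrderIdeal.count_vs_choose (hN : IsLexOrderIdeal N)
    {M : Set (Fin (q + 1) →₀ ℕ)} (h : IsExtension M N) (t : ℕ) :
    (Finsupp.single q t ∈ N → count N t = (q + t).choose t) ∧
      (Finsupp.single q t ∉ N → count N t < (q + t).choose t) := by
  classical
  have hc : (terms (Finset.univ : Finset (Fin (q + 1))) t).card = (q + t).choose t := by
    rw [terms, Finset.card_finsuppAntidiag_nat_eq_choose, Finset.card_univ, Fintype.card_fin]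
    congr 1
    omega
  rw [h.count_eq, ← hc]
  constructor
  · intro hq
    rw [Finset.filter_true_of_mem]
    intro α hα
    refine h.extend_mem_iff.1 (hN.mem_of_single_mem hq ?_ fun k hk => extend_apply_of_le α hk)
    rw [degree_extend, mem_terms_univ.1 hα]
  · intro hq
    refine Finset.card_lt_card (Finset.filter_ssubset.2 ⟨Finsupp.single (Fin.last q) t, ?_, ?_⟩)
    · rw [mem_terms_univ, Finsupp.degree_single]
    · rwa [← h.extend_mem_iff, extend_single, Fin.val_last]

/-- The sous-escaliers of the lex-segment ideals in question are exactly the lex-segment order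
ideals counted by the recursion, read in `q + 1` variables. -/
theorem lexSousEscaliers_eq_image (hd : 1 ≤ d) :
    lexSousEscaliers K (q + 1) n k d =
      (fun N : Finset (ℕ →₀ ℕ) => extend (p := q + 1) ⁻¹' (N : Set (ℕ →₀ ℕ))) ''
        (lexIdeals q n k d : Set (Finset (ℕ →₀ ℕ))) := by
  ext M
  constructor
  · rintro ⟨J, ⟨hJ, hlex⟩, -, rfl, hm, ⟨s, hsn, hs⟩, hk, hk'⟩
    have hst := standardTerms_eq_sousEscalier hJ
    obtain ⟨N, hN⟩ := exists_isExtension (finite_standardTerms (I := J) (by omega))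
    rw [hN.hilbertFn_eq] at hm hs hk hk'
    have hlow := isLowerSet_standardTerms J
    rw [hst] at hN hlow
    have hNlex := hN.isLexOrderIdeal hlow hlex
    refine ⟨N, mem_lexIdeals.2 ⟨hNlex, by rw [← multiplicity_count, hm], ?_, ?_, ?_, ?_⟩,
      hN.preimage_eq⟩
    · intro τ hτ
      by_contra! h
      exact count_ne_zero_iff.2 ⟨τ, hτ, rfl⟩ (hs.2 _ (by omega))
    · intro h
      obtain ⟨α, -, hα⟩ := hN.mem_iff.1 h
      have := extend_apply_of_le α (le_refl (q + 1))
      rw [hα] at this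
      simp at this
    · by_contra h
      have h1 := (hNlex.count_vs_choose hN k).2 h
      have h2 := hk k le_rfl
      rw [Nat.add_sub_cancel] at h2
      omega
    · intro h
      have h1 := (hNlex.count_vs_choose hN (k + 1)).1 h
      have h2 := hk' (k + 1) (Nat.lt_succ_self k)
      rw [Nat.add_sub_cancel] at h2
      omega
  · rintro ⟨N, hN, rfl⟩
    obtain ⟨hN, hc, hn, h1, h2, h3⟩ := mem_lexIdeals.1 (Finset.mem_coe.1 hN)
    have hE := isExtension_preimage (p := q + 1) fun τ hτ => hN.apply_eq_zero h1 hτ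
    set M := extend (p := q + 1) ⁻¹' (N : Set (ℕ →₀ ℕ)) with hM
    have hsous := sousEscalier_idealOf (K := K) (hE.isLowerSet hN)
    have hH := hE.hilbertFn_idealOf (K := K) (hE.isLowerSet hN)
    refine ⟨idealOf K M, ⟨isMonomialIdeal_idealOf M, ?_⟩, isArtinianRing_idealOf ?_, hsous.symm,
      ?_, ?_, ?_, ?_⟩
    · rw [hsous]
      intro β hβ α hd hlt
      refine hN.lex _ _ ?_ (extend_colex_lt_iff.2 hlt) hβ
      rw [degree_extend, degree_extend, hd]
    · exact N.finite_toSet.preimage extend_injective.injOn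
    · rw [hH, multiplicity_count, hc]
    · obtain ⟨s, hs, hs'⟩ := hN.exists_top (hN.zero_mem h2) 0
      have hsn := hn _ hs
      rw [Finsupp.degree_single] at hsn
      refine ⟨s, hsn, ?_⟩
      rw [hH]
      refine ⟨count_ne_zero_iff.2 ⟨_, hs, Finsupp.degree_single _ _⟩, fun i hi => ?_⟩
      by_contra hne
      obtain ⟨τ, hτ, rfl⟩ := count_ne_zero_iff.1 hne
      have := hN.le_of_single_mem (hN.single_zero_degree_mem hτ) hs'
      omega
    · intro i hi
      rw [hH, Nat.add_sub_cancel]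
      exact (hN.count_vs_choose hE i).1 (hN.single_mem_of_le hi h2)
    · intro i hi
      rw [hH, Nat.add_sub_cancel]
      exact (hN.count_vs_choose hE i).2 fun h => h3 (hN.single_mem_of_le hi h)

theorem numLex_eq_card (hd : 1 ≤ d) : numLex K (q + 1) n k d = (lexIdeals q n k d).card := by
  rw [numLex, lexSousEscaliers_eq_image hd, Set.InjOn.ncard_image, Set.ncard_coe_finset]
  intro N hN N' hN' h
  have hE : ∀ {N}, N ∈ (lexIdeals q n k d : Set (Finset (ℕ →₀ ℕ))) →
      IsExtension (extend (p := q + 1) ⁻¹' (N : Set (ℕ →₀ ℕ))) N := by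
    intro N hN
    obtain ⟨hN, -, -, h1, -⟩ := mem_lexIdeals.1 (Finset.mem_coe.1 hN)
    exact isExtension_preimage fun τ hτ => hN.apply_eq_zero h1 hτ
  refine Finset.coe_injective ?_
  rw [hE hN, hE hN']
  exact congrArg _ h

/-- The finite `O`-sequences are the Hilbert functions of the lex-segment order ideals. -/
theorem finiteOSequences_eq_image (K : Type*) [Field K] (q : ℕ) :
    finiteOSequences K (q + 1) =
      count '' (lexIdeals q q 0 (q + 1) : Set (Finset (ℕ →₀ ℕ))) := by
  ext a
  constructor
  · rintro ⟨⟨p, I, -, -, -, rfl⟩, hm⟩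
    obtain ⟨N, hN⟩ := exists_isExtension (finite_standardTerms (I := I) (by omega))
    obtain ⟨L, hL, hLN⟩ := exists_isLexOrderIdeal_count_eq
      (hN.lower (isLowerSet_standardTerms I))
    rw [hN.hilbertFn_eq, ← hLN] at hm ⊢
    exact ⟨L, mem_lexIdeals_self.2 ⟨hL, by rw [← multiplicity_count, hm]⟩, rfl⟩
  · rintro ⟨N, hN, rfl⟩
    obtain ⟨hN, hc, -, h1, h2, -⟩ := mem_lexIdeals.1 (Finset.mem_coe.1 hN)
    have hE := isExtension_preimage (p := q + 1) fun τ hτ => hN.apply_eq_zero h1 hτ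
    set M := extend (p := q + 1) ⁻¹' (N : Set (ℕ →₀ ℕ)) with hM
    have hsous := sousEscalier_idealOf (K := K) (hE.isLowerSet hN)
    have hH := hE.hilbertFn_idealOf (K := K) (hE.isLowerSet hN)
    refine ⟨⟨q + 1, idealOf K M, isHomogeneous_idealOf M, ?_,
      isArtinianRing_idealOf (N.finite_toSet.preimage extend_injective.injOn), hH.symm⟩, ?_⟩
    · intro htop
      obtain ⟨α, hα, -⟩ := hE.mem_iff.1 (hN.zero_mem h2)
      rw [← hsous, htop] at hα
      exact hα trivial
    · rw [multiplicity_count, hc]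

theorem numO_eq_card (K : Type*) [Field K] (q : ℕ) :
    numO K (q + 1) = (lexIdeals q q 0 (q + 1)).card := by
  rw [numO, finiteOSequences_eq_image, Set.InjOn.ncard_image, Set.ncard_coe_finset]
  intro N hN N' hN' h
  exact (mem_lexIdeals.1 (Finset.mem_coe.1 hN)).1.eq_of_count_eq
    (mem_lexIdeals.1 (Finset.mem_coe.1 hN')).1 h

end translate

end OSeq

theorem corollary4p4 (K : Type*) [Field K] :
    -- all the sets that are counted are finite
    (∀ d : ℕ, 1 ≤ d → (OSeq.finiteOSequences K d).Finite) ∧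
    (∀ p n k d : ℕ, 1 ≤ p → 1 ≤ d → (OSeq.lexSousEscaliers K p n k d).Finite) ∧
    -- start of the iteration
    (∀ d : ℕ, 1 ≤ d → OSeq.numO K d = OSeq.numLex K d (d - 1) 0 d) ∧
    -- base case of one variable
    (∀ n k d : ℕ, 1 ≤ d →
      OSeq.numLex K 1 n k d = if k = d - 1 ∧ d - 1 ≤ n then 1 else 0) ∧
    -- base case `k = 0`
    (∀ p n d : ℕ, 2 ≤ p → 1 ≤ d →
      OSeq.numLex K p n 0 d = ∑ k ∈ Finset.Icc 0 (d - 1), OSeq.numLex K (p - 1) n k d) ∧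
    -- recursion for `k > 0`
    (∀ p n k d : ℕ, 2 ≤ p → 1 ≤ k → 1 ≤ d →
      OSeq.numLex K p n k d =
        ∑ j ∈ Finset.Icc 1 (d - 1), ∑ i ∈ Finset.Icc k n,
          OSeq.numLex K (p - 1) n i (d - j) * OSeq.numLex K p (i - 1) (k - 1) j) ∧
    -- the iteration computes all the numbers `O(p, n, k, d)`, in particular `O_d`
    (∀ p n k d : ℕ, 1 ≤ p → 1 ≤ d → OSeq.numLex K p n k d = OSeq.iter p n k d) ∧
    (∀ d : ℕ, 2 ≤ d → OSeq.numO K d = OSeq.iter d (d - 1) 0 d) := by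
  open OSeq in
  have hiter : ∀ p n k d : ℕ, 1 ≤ p → 1 ≤ d → numLex K p n k d = iter p n k d := by
    intro p n k d hp hd
    obtain ⟨q, rfl⟩ := Nat.exists_eq_add_of_le' hp
    rw [numLex_eq_card hd, card_lexIdeals_eq_iter]
  have hO : ∀ d : ℕ, 1 ≤ d → numO K d = numLex K d (d - 1) 0 d := by
    intro d hd
    obtain ⟨q, rfl⟩ := Nat.exists_eq_add_of_le' hd
    rw [numO_eq_card, numLex_eq_card hd, Nat.add_sub_cancel]
  refine ⟨?_, ?_, hO, ?_, ?_, ?_, hiter, ?_⟩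
  · intro d hd
    obtain ⟨q, rfl⟩ := Nat.exists_eq_add_of_le' hd
    rw [finiteOSequences_eq_image]
    exact (Finset.finite_toSet _).image _
  · intro p n k d hp hd
    obtain ⟨q, rfl⟩ := Nat.exists_eq_add_of_le' hp
    rw [lexSousEscaliers_eq_image hd]
    exact (Finset.finite_toSet _).image _
  · intro n k d hd
    rw [numLex_eq_card (q := 0) hd, card_lexIdeals_zero]
    congr 1
    rw [eq_iff_iff]
    omega
  · intro p n d hp hd
    obtain ⟨q, rfl⟩ := Nat.exists_eq_add_of_le' hp
    have hr : Finset.Icc 0 (d - 1) = Finset.range d := by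
      ext k; rw [Finset.mem_Icc, Finset.mem_range]; omega
    rw [numLex_eq_card (q := q + 1) hd, card_lexIdeals_succ_zero, hr]
    exact Finset.sum_congr rfl fun k _ => (numLex_eq_card (q := q) hd).symm
  · intro p n k d hp hk hd
    obtain ⟨q, rfl⟩ := Nat.exists_eq_add_of_le' hp
    obtain ⟨k, rfl⟩ := Nat.exists_eq_add_of_le' hk
    rw [numLex_eq_card (q := q + 1) hd, card_lexIdeals_succ_succ]
    refine Finset.sum_congr rfl fun j hj => Finset.sum_congr rfl fun i _ => ?_
    rw [Finset.mem_Icc] at hj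
    rw [show q + 2 - 1 = q + 1 from rfl, numLex_eq_card (q := q) (by omega),
      numLex_eq_card (q := q + 1) hj.1, Nat.add_sub_cancel]
  · intro d hd
    rw [hO d (by omega), hiter d _ _ d (by omega) (by omega)]
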